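/- \textbf{Setting.} Interfering controllers are located at the points of a homogeneous Poisson point process $\Phi=\{x_1,x_2,\dots\}$ of intensity $\lambda>0$ on $\mathbb R^2$; the typical actuator is at the origin and its own (typical) controller is at distance $r_0>0$. Fix $\alpha,\rho,\eta,\gamma>0$, $N_0\ge 0$ and access probabilities $p_1,\dots,p_D\in[0,1]$, $D\ge 1$. If the ALOHA parameter $q$ is used, then in a slot each controller $i=0,1,2,\dots$ ($0$ is the typical one) is active, $C_i=1$, with probability $q$ and otherwise $C_i=0$; its fading power $|h_i|^2$ is exponential with mean $1$; all these variables are independent of each other and of $\Phi$. The acknowledgment of the slot is $S=1$ if $C_0\,\xi>\gamma$ and $S=0$ otherwise, where \[ \xi=\frac{\eta\rho|h_0|^2r_0^{-\alpha}}{N_0+\sum_{i\ge1}C_i\,\eta\rho|h_i|^2\|x_i\|^{-\alpha}} . \] Let $\mu_\Phi(q)=\mathbb P(S=1\mid\Phi,q)$ (equivalently $q\bar S(q)$, with $\bar S(q)$ the success probability given that the typical controller transmits). Time is divided into blocks $k=0,1,\dots$ of $T$ slots. Given $\Phi$ and the ALOHA parameter $q(k)$ chosen for block $k$, the $T$ acknowledgments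 of block $k$ are independent and identically distributed with this one-slot law, and independent of the earlier blocks. \textbf{Block Thompson sampling.} Start with $a_d=b_d=1$ for all $d\le D$. In block $k$ draw independent $\theta_d\sim\mathrm{Beta}(a_d,b_d)$, let $d^*=\arg\max_d\theta_d$, use $q(k)=p_{d^*}$ during the block, and at its end replace $a_{d^*}$ by $a_{d^*}+\Sigma$ and $b_{d^*}$ by $b_{d^*}+T-\Sigma$, where $\Sigma$ is the sum of the $T$ acknowledgments of the block. Its Bayesian regret over $K$ blocks is \[ \mathcal R_{\rm TS}(K)=\mathbb E\Big[\sum_{k=0}^{K-1}T\big(\max_{d}\mu_\Phi(p_d)-\mu_\Phi(q(k))\big)\Big], \] the expectation being over $\Phi$, the acknowledgments and the sampling of the algorithm. \textbf{Proposition.} $\mathcal R_{\rm TS}(K)=O\big(\sqrt{TKD\log K}\big)$ as $K$ grows. Precisely, there is an absolute constant $C>0$ such that, for all choices of the parameters above and all $T$, $D$, $K$ with $TD\le K\log K$, the regret given $\Phi$ is an integrable function of $\Phi$ and \[ \mathcal R_{\rm TS}(K)\le C\sqrt{TKD\log K}. \] -/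

import Mathlib

open MeasureTheory ProbabilityTheory
open scoped ENNReal

noncomputable section

namespace AlohaTS

/-- The plane in which the controllers are located. -/
abbrev Plane : Type := EuclideanSpace ℝ (Fin 2)

/-- A sequence of random points `X 0, X 1, …` enumerates a homogeneous Poisson point process of
intensity `lam` on the plane: the number of points in a Borel set `B` of finite area is Poisson
distributed with mean `lam * area B`, and the numbers of points in finitely many pairwise disjoint
such sets are independent. (For `lam > 0` the process has infinitely many points, so
that it is enumerated by `ℕ`.) -/
structure IsPoissonProcess {Ω : Type*} [MeasurableSpace Ω] (lam : ℝ) (X : ℕ → Ω → Plane)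
    (P : Measure Ω) : Prop where
  measurable_point : ∀ i, Measurable (X i)
  count_law : ∀ B : Set Plane, MeasurableSet B → volume B ≠ ∞ → ∀ n : ℕ,
    P {ω | {i | X i ω ∈ B}.encard = n} = poissonMeasure (lam * volume.real B).toNNReal {n}
  count_indep : ∀ (m : ℕ) (B : Fin m → Set Plane), (∀ j, MeasurableSet (B j)) →
    (∀ j, volume (B j) ≠ ∞) → Pairwise (fun j l => Disjoint (B j) (B l)) →
    iIndepFun (fun j ω => {i | X i ω ∈ B j}.encard) P

/-- The parameters of the wireless network. -/
structure Network where
  /-- intensity `λ` of the interfering controllers -/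
  intensity : ℝ
  /-- distance `r₀` between the typical controller and the typical actuator -/
  linkDist : ℝ
  /-- path-loss exponent `α` -/
  pathExp : ℝ
  /-- path-loss constant `ρ` -/
  pathConst : ℝ
  /-- transmit power `η` -/
  power : ℝ
  /-- noise power `N₀` -/
  noise : ℝ
  /-- decoding threshold `γ` -/
  threshold : ℝ
  intensity_pos : 0 < intensity
  linkDist_pos : 0 < linkDist
  pathExp_pos : 0 < pathExp
  pathConst_pos : 0 < pathConst
  power_pos : 0 < power
  noise_nonneg : 0 ≤ noise
  threshold_pos : 0 < threshold

/-- The channel in one slot: for every controller (index `0` is the typical one, index `i + 1` is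
the one located at the `i`-th point of the process) its access state and its fading power `|h|²`
towards the typical actuator. -/
abbrev Slot : Type := (ℕ → Bool) × (ℕ → ℝ)

/-- The law of the channel in one slot under the ALOHA parameter `q`: every controller is active
with probability `q`, all fading powers are exponential with mean one (Rayleigh fading), and
everything is independent. -/
def slotLaw (q : unitInterval) : Measure Slot :=
  (Measure.infinitePi fun _ : ℕ => bernoulliMeasure true false q).prod
    (Measure.infinitePi fun _ : ℕ => expMeasure 1)

/-- Power received at the typical actuator (the origin) from a transmitter at distance `r` with
fading power `g`; it is infinite at distance `0`. -/
def rxPower (net : Network) (g : ℝ) (r : ℝ≥0∞) : ℝ≥0∞ :=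
  ENNReal.ofReal (net.power * net.pathConst * g) * r ^ (-net.pathExp)

/-- Total power received from the active interferers, located at the points of `x`. -/
def interference (net : Network) (x : ℕ → Plane) (s : Slot) : ℝ≥0∞ :=
  ∑' i : ℕ, if s.1 (i + 1) then rxPower net (s.2 (i + 1)) ‖x i‖ₑ else 0

/-- Signal-to-interference-plus-noise ratio at the typical actuator. -/
def sinr (net : Network) (x : ℕ → Plane) (s : Slot) : ℝ≥0∞ :=
  rxPower net (s.2 0) (ENNReal.ofReal net.linkDist) /
    (ENNReal.ofReal net.noise + interference net x s)

open Classical in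
/-- The acknowledgment of a slot: the typical controller transmits and is decoded. -/
def slotAck (net : Network) (x : ℕ → Plane) (s : Slot) : Bool :=
  decide (s.1 0 = true ∧ ENNReal.ofReal net.threshold < sinr net x s)

/-- The law of the acknowledgment of one slot, given the locations `x` of the interferers and the
ALOHA parameter `q`. It is the same whether access states are redrawn in each slot or in each
block. -/
def ackLaw (net : Network) (x : ℕ → Plane) (q : unitInterval) : Measure Bool :=
  (slotLaw q).map (slotAck net x)

/-- The mean reward of one slot, given the locations `x`: the probability that the typical
controller is active and decoded under the ALOHA parameter `q`. -/
def meanReward (net : Network) (x : ℕ → Plane) (q : unitInterval) : ℝ :=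
  (ackLaw net x q).real {true}

/-- The `T` acknowledgments of a block with ALOHA parameter `q`: given the locations they are
independent and identically distributed across the slots. -/
def blockLaw (net : Network) (x : ℕ → Plane) (T : ℕ) (q : unitInterval) : Measure (Fin T → Bool) :=
  Measure.pi fun _ => ackLaw net x q

/-- What is recorded in a block: the index of the chosen access probability and the `T`
acknowledgments. -/
abbrev Record (D T : ℕ) : Type := Fin D × (Fin T → Bool)

/-- Number of successful slots in a block. -/
def successes {T : ℕ} (s : Fin T → Bool) : ℕ := (Finset.univ.filter fun t => s t = true).card

/-- First Beta parameter of arm `d` after the blocks `h`: it starts at `1` and is increased by the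
number of successes in each block that used `d`. -/
def betaA {D T k : ℕ} (h : Fin k → Record D T) (d : Fin D) : ℕ :=
  1 + ∑ j, if (h j).1 = d then successes (h j).2 else 0

/-- Second Beta parameter of arm `d` after the blocks `h`: it starts at `1` and is increased by the
number of failures in each block that used `d`. -/
def betaB {D T k : ℕ} (h : Fin k → Record D T) (d : Fin D) : ℕ :=
  1 + ∑ j, if (h j).1 = d then T - successes (h j).2 else 0

open Classical in
/-- The (smallest) index of a largest entry. -/
def argmax {D : ℕ} [NeZero D] (θ : Fin D → ℝ) : Fin D :=
  (Finset.univ.filter fun d => ∀ e, θ e ≤ θ d).min' (by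
    obtain ⟨d, hd⟩ := Finite.exists_max θ
    exact ⟨d, by simpa using hd⟩)

/-- The law of the arm chosen by Thompson sampling after the blocks `h`: draw independent samples
`θ d` from the Beta distributions with the current parameters and take the arm of the largest. -/
def armLaw {D T k : ℕ} [NeZero D] (h : Fin k → Record D T) : Measure (Fin D) :=
  (Measure.pi fun d => betaMeasure (betaA h d) (betaB h d)).map argmax

/-- The law of the first `k` blocks of block Thompson sampling over the access probabilities `p`,
given the locations `x` of the interferers. -/
def runLaw (net : Network) (x : ℕ → Plane) {D : ℕ} [NeZero D] (p : Fin D → unitInterval) (T : ℕ) :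
    (k : ℕ) → Measure (Fin k → Record D T)
  | 0 => Measure.dirac Fin.elim0
  | k + 1 => (runLaw net x p T k).bind fun h => (armLaw h).bind fun d =>
      (blockLaw net x T (p d)).map fun s => Fin.snoc (α := fun _ => Record D T) h (d, s)

/-- The expected regret over `K` blocks of `T` slots, given the locations `x`: the regret of a block
is `T` times the gap between the best mean reward and that of the chosen access probability. -/
def condRegret (net : Network) (x : ℕ → Plane) {D : ℕ} [NeZero D] (p : Fin D → unitInterval)
    (T K : ℕ) : ℝ :=
  ∫ h, ∑ k : Fin K, (T : ℝ) *
    ((⨆ d, meanReward net x (p d)) - meanReward net x (p (h k).1)) ∂(runLaw net x p T K)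

/-- The Bayesian regret: the expectation of the regret over the point process `X` of interferers. -/
def bayesRegret {Ω : Type*} [MeasurableSpace Ω] (P : Measure Ω) (X : ℕ → Ω → Plane)
    (net : Network) {D : ℕ} [NeZero D] (p : Fin D → unitInterval) (T K : ℕ) : ℝ :=
  ∫ ω, condRegret net (fun i => X i ω) p T K ∂P

end AlohaTS

end

/-!
The regret given the locations `x` of the interferers is bounded for every `x`; as a measurable
function of `x` (`measurable_condRegret`) the bound can then be averaged over the point process.
Given `x`, the algorithm is Thompson sampling for a Bernoulli bandit with mean rewards `μ d`, and
all laws of histories are laws on finite types.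

Let arm `c` be optimal and let arm `d` have gap `δ = μ c - μ d > 0`. With the threshold
`y = μ c - δ / 2` between the two means, arm `d` is used for one of three reasons.

* No sample exceeds `y`. Since the samples are independent, this is at most the odds against the
  sample of `c` exceeding `y` times the probability of using `c` (`pi_argmax_real_le`). The tail of
  a Beta distribution with integer parameters is a binomial probability (`betaMeasure_real_Ioi`), so
  the total over all blocks is governed by
  `∑ s, binWeight n (μ c) s * (1 / binCdf (n + 1) y s - 1)` for `n = 0, T, 2 * T, …`. This is at
  most a constant over `(n + 1) * δ ^ 2` (`sum_binWeight_odds_le`). With a success probability `z`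
  halfway between `y` and `μ c`, the `s` above `n * z` are treated by Cantelli's inequality, those
  below by a bound on the reversed hazard rate of the binomial law (`binWeight_mul_le_binCdf`)
  together with the geometric decay of the likelihood ratio of `μ c` and `z`. Summation over `n`
  gives `O (1 / δ + log K / (T * δ ^ 2))` blocks.
* Arm `d` has been tried in fewer than `16 * log K / δ ^ 2` slots, or its success rate exceeds `μ d`
  by `δ / 4`. Chebyshev's inequality suffices to bound the number of these uses
  (`sum_unsettled_le`).
* Otherwise its sample exceeds `y` with probability at most `1 / K`, by Chernoff's bound
  (`binCdf_le_of_le`).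

The passage from the random times at which an arm is used to its successive uses is a
supermartingale argument (`sum_integral_armLaw_mul_le`). Altogether an arm of gap `δ` costs
`O (T + log K / δ)` (`expectedPulls_le`). Arms with `δ ≤ √(D * log K / (T * K))` cost at most
`√(T * K * D * log K)` in total, the others at most `O (T * D + √(T * K * D * log K))`, and `T * D`
is dominated because `T * D ≤ K * log K` (`condRegret_le`).
-/

noncomputable section

namespace AlohaTS

/-! ### Binomial weights and distribution function -/

/-- The probability of `i` successes in `n` independent trials of success probability `p`. -/
def binWeight (n : ℕ) (p : ℝ) (i : ℕ) : ℝ := n.choose i * p ^ i * (1 - p) ^ (n - i)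

/-- The probability of at most `s` successes in `n` independent trials of success
probability `p`. -/
def binCdf (n : ℕ) (p : ℝ) (s : ℕ) : ℝ := ∑ i ∈ Finset.range (s + 1), binWeight n p i

lemma binWeight_eq_eval (n : ℕ) (p : ℝ) (i : ℕ) :
    binWeight n p i = (bernsteinPolynomial ℝ n i).eval p := by
  simp [binWeight, bernsteinPolynomial]

lemma binWeight_nonneg {p : ℝ} (h0 : 0 ≤ p) (h1 : p ≤ 1) (n i : ℕ) : 0 ≤ binWeight n p i := by
  have : 0 ≤ 1 - p := by linarith
  unfold binWeight; positivity

lemma binWeight_eq_zero {n i : ℕ} (h : n < i) (p : ℝ) : binWeight n p i = 0 := by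
  simp [binWeight, Nat.choose_eq_zero_of_lt h]

lemma sum_binWeight (n : ℕ) (p : ℝ) : ∑ i ∈ Finset.range (n + 1), binWeight n p i = 1 := by
  have := congrArg (Polynomial.eval p) (bernsteinPolynomial.sum ℝ n)
  simpa [Polynomial.eval_finsetSum, binWeight_eq_eval] using this

lemma sum_mul_binWeight (n : ℕ) (p : ℝ) :
    ∑ i ∈ Finset.range (n + 1), (i : ℝ) * binWeight n p i = n * p := by
  have := congrArg (Polynomial.eval p) (bernsteinPolynomial.sum_smul ℝ n)
  simpa [Polynomial.eval_finsetSum, binWeight_eq_eval] using this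

lemma sum_sq_mul_binWeight (n : ℕ) (p : ℝ) :
    ∑ i ∈ Finset.range (n + 1), (n * p - i : ℝ) ^ 2 * binWeight n p i = n * p * (1 - p) := by
  have := congrArg (Polynomial.eval p) (bernsteinPolynomial.variance ℝ n)
  simpa [Polynomial.eval_finsetSum, binWeight_eq_eval] using this

lemma binCdf_nonneg {p : ℝ} (h0 : 0 ≤ p) (h1 : p ≤ 1) (n s : ℕ) : 0 ≤ binCdf n p s :=
  Finset.sum_nonneg fun i _ => binWeight_nonneg h0 h1 n i

lemma binCdf_pos {p : ℝ} (h0 : 0 ≤ p) (h1 : p < 1) (n s : ℕ) : 0 < binCdf n p s := by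
  have h : binWeight n p 0 ≤ binCdf n p s :=
    Finset.single_le_sum (f := fun i => binWeight n p i)
      (fun i _ => binWeight_nonneg h0 h1.le n i) (by simp)
  have : 0 < binWeight n p 0 := by
    have : 0 < 1 - p := by linarith
    simp only [binWeight]; simp; positivity
  linarith

lemma binCdf_eq_one {n s : ℕ} (h : n ≤ s) (p : ℝ) : binCdf n p s = 1 := by
  rw [← sum_binWeight n p, binCdf]
  symm
  refine Finset.sum_subset (by simpa using h) fun i _ hi => binWeight_eq_zero ?_ p
  simpa [Nat.lt_succ_iff] using hi

lemma binCdf_succ (n : ℕ) (p : ℝ) (s : ℕ) :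
    binCdf n p (s + 1) = binCdf n p s + binWeight n p (s + 1) := by
  simp [binCdf, Finset.sum_range_succ]

lemma binCdf_mono {p : ℝ} (h0 : 0 ≤ p) (h1 : p ≤ 1) (n : ℕ) : Monotone (binCdf n p) :=
  monotone_nat_of_le_succ fun s => by
    rw [binCdf_succ]; linarith [binWeight_nonneg h0 h1 n (s + 1)]

lemma binCdf_le_one {p : ℝ} (h0 : 0 ≤ p) (h1 : p ≤ 1) (n s : ℕ) : binCdf n p s ≤ 1 := by
  rw [← binCdf_eq_one (le_max_left n s) p]
  exact binCdf_mono h0 h1 n (le_max_right n s)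

/-- In the derivative of the binomial distribution function in the success probability
all terms but one cancel. -/
lemma hasDerivAt_binCdf (n s : ℕ) (p : ℝ) :
    HasDerivAt (fun p => binCdf (n + 1) p s) (-((n + 1) * binWeight n p s)) p := by
  induction s with
  | zero =>
    have h := (bernsteinPolynomial ℝ (n + 1) 0).hasDerivAt p
    rw [bernsteinPolynomial.derivative_zero] at h
    convert! h using 1
    · ext q; simp [binCdf, binWeight_eq_eval]
    · simp [binWeight_eq_eval]; ring
  | succ s ih =>
    have h := (bernsteinPolynomial ℝ (n + 1) (s + 1)).hasDerivAt p
    rw [bernsteinPolynomial.derivative_succ_aux] at h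
    have := ih.add h
    simp only [binCdf_succ]
    convert! this using 1
    · ext q; simp [binWeight_eq_eval]
    · simp [binWeight_eq_eval]; ring

lemma binCdf_antitoneOn (n s : ℕ) :
    AntitoneOn (fun p => binCdf (n + 1) p s) (Set.Icc 0 1) := by
  refine antitoneOn_of_deriv_nonpos (convex_Icc 0 1)
    (fun p _ => (hasDerivAt_binCdf n s p).continuousAt.continuousWithinAt)
    (fun p _ => (hasDerivAt_binCdf n s p).differentiableAt.differentiableWithinAt) fun p hp => ?_
  rw [interior_Icc] at hp
  rw [(hasDerivAt_binCdf n s p).deriv]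
  have := binWeight_nonneg hp.1.le hp.2.le n s
  have : 0 ≤ ((n : ℝ) + 1) * binWeight n p s := by positivity
  linarith

/-! ### Tail bounds with polynomial decay -/

/-- A one-sided Chebyshev (Cantelli) inequality: if `s + 1` exceeds the mean by at least `a`, the
odds of more than `s` successes are at most the variance divided by `a ^ 2`. -/
lemma one_div_binCdf_sub_one_le {n s : ℕ} {p a : ℝ} (h0 : 0 ≤ p) (h1 : p < 1) (ha : 0 < a)
    (hs : n * p + a ≤ s + 1) :
    1 / binCdf n p s - 1 ≤ n * p * (1 - p) / a ^ 2 := by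
  have hF := binCdf_pos h0 h1 n s
  rcases le_or_gt n s with hns | hns
  · rw [binCdf_eq_one hns]
    have : 0 ≤ 1 - p := by linarith
    simp; positivity
  set V := (n : ℝ) * p * (1 - p) with hV
  have hV0 : 0 ≤ V := by
    have : 0 ≤ 1 - p := by linarith
    positivity
  -- The second moment about the shifted centre `n * p - V / a`.
  have hmom : ∑ i ∈ Finset.range (n + 1), ((i : ℝ) - n * p + V / a) ^ 2 * binWeight n p i =
      V + (V / a) ^ 2 := by
    have e : ∀ i ∈ Finset.range (n + 1), ((i : ℝ) - n * p + V / a) ^ 2 * binWeight n p i =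
        (n * p - i : ℝ) ^ 2 * binWeight n p i + 2 * (V / a) * (i * binWeight n p i)
          + ((V / a) ^ 2 - 2 * (V / a) * (n * p)) * binWeight n p i := fun i _ => by ring
    rw [Finset.sum_congr rfl e, Finset.sum_add_distrib, Finset.sum_add_distrib, ← Finset.mul_sum,
      ← Finset.mul_sum, sum_binWeight, sum_mul_binWeight, sum_sq_mul_binWeight]
    ring
  have hsplit := Finset.sum_range_add_sum_Ico (fun i => binWeight n p i)
    (show s + 1 ≤ n + 1 by omega)
  rw [sum_binWeight] at hsplit
  have htail : (a + V / a) ^ 2 * (1 - binCdf n p s) ≤ V + (V / a) ^ 2 := by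
    have e : 1 - binCdf n p s = ∑ i ∈ Finset.Ico (s + 1) (n + 1), binWeight n p i := by
      rw [binCdf]; linarith
    rw [e, Finset.mul_sum, ← hmom]
    refine (Finset.sum_le_sum fun i hi => ?_).trans
      (Finset.sum_le_sum_of_subset_of_nonneg
        (f := fun i : ℕ => ((i : ℝ) - n * p + V / a) ^ 2 * binWeight n p i) (fun i hi => ?_)
        fun i _ _ => mul_nonneg (sq_nonneg _) (binWeight_nonneg h0 h1.le n i))
    · refine mul_le_mul_of_nonneg_right ?_ (binWeight_nonneg h0 h1.le n i)
      have : ((s : ℝ) + 1) ≤ i := by exact_mod_cast (Finset.mem_Ico.1 hi).1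
      have : 0 ≤ V / a := by positivity
      gcongr; linarith
    · simp at hi ⊢; omega
  have key : a ^ 2 * (1 - binCdf n p s) ≤ V * binCdf n p s := by
    have hx : (a + V / a) ^ 2 = (a ^ 2 + V) * ((a ^ 2 + V) / a ^ 2) := by field_simp
    have hy : V + (V / a) ^ 2 = V * ((a ^ 2 + V) / a ^ 2) := by field_simp
    rw [hx, hy] at htail
    have hpos : 0 < (a ^ 2 + V) / a ^ 2 := by positivity
    have : (a ^ 2 + V) * (1 - binCdf n p s) ≤ V := by
      refine le_of_mul_le_mul_right ?_ hpos
      linarith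
    linarith
  rw [div_sub_one hF.ne', div_le_div_iff₀ hF (by positivity)]
  linarith

/-- Chebyshev's inequality for the upper tail of the binomial law. -/
lemma sum_binWeight_of_gt_le {n : ℕ} {p x : ℝ} (h0 : 0 ≤ p) (h1 : p ≤ 1) (hx : p < x) (hn : 0 < n) :
    ∑ i ∈ Finset.range (n + 1), binWeight n p i * (if x * n < i then 1 else 0) ≤
      1 / (n * (x - p) ^ 2) := by
  have hn' : (0 : ℝ) < n := by exact_mod_cast hn
  have hxp : 0 < x - p := by linarith
  rw [le_div_iff₀ (by positivity)]
  have h : (∑ i ∈ Finset.range (n + 1), binWeight n p i * (if x * n < i then 1 else 0)) *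
      (n * (x - p)) ^ 2 ≤ ∑ i ∈ Finset.range (n + 1), (n * p - i : ℝ) ^ 2 * binWeight n p i := by
    rw [Finset.sum_mul]
    refine Finset.sum_le_sum fun i _ => ?_
    have := binWeight_nonneg h0 h1 n i
    split_ifs with hi
    · rw [mul_one, mul_comm]
      refine mul_le_mul_of_nonneg_right ?_ this
      rw [← neg_sq ((n : ℝ) * p - i)]
      gcongr
      linarith
    · simp; positivity
  rw [sum_sq_mul_binWeight] at h
  have : (n : ℝ) * p * (1 - p) ≤ n := by
    have : p * (1 - p) ≤ 1 := by nlinarith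
    nlinarith
  have h2 : (n : ℝ) * ((∑ i ∈ Finset.range (n + 1), binWeight n p i *
      (if x * n < i then 1 else 0)) * (n * (x - p) ^ 2)) ≤ n * 1 := by
    rw [mul_one]; refine le_trans (le_of_eq ?_) (h.trans this); ring
  exact le_of_mul_le_mul_left h2 hn'

/-! ### The exponential tail bound -/

/-- The likelihood ratio of the success probabilities `u` and `v` at a number of successes
compatible with `v`: a Chernoff bound in which the relative entropy is bounded below by the
squared distance of the two probabilities (through the Bhattacharyya coefficient). -/
lemma likelihood_ratio_le {n s : ℕ} {u v : ℝ} (hv0 : 0 < v) (hvu : v ≤ u) (hu : u ≤ 1) (hv1 : v < 1)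
    (hs : s ≤ n * v) :
    (u / v) ^ s * ((1 - u) / (1 - v)) ^ (n - s) ≤ (1 - (u - v) ^ 2) ^ n := by
  have hsn : s ≤ n := by
    have : (s : ℝ) ≤ n := hs.trans (by nlinarith [(Nat.cast_nonneg n : (0 : ℝ) ≤ n)])
    exact_mod_cast this
  have hv1' : 0 < 1 - v := by linarith
  have hu1' : 0 ≤ 1 - u := by linarith
  have hu0 : 0 < u := by linarith
  set a := u / v with ha
  set c := (1 - u) / (1 - v) with hc
  have ha1 : 1 ≤ a := by rw [ha, le_div_iff₀ hv0]; linarith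
  have hc0 : 0 ≤ c := by positivity
  have hc1 : c ≤ 1 := by rw [hc, div_le_one hv1']; linarith
  -- Move the exponents to the real numbers `n * v` and `n * (1 - v)`.
  have h1 : a ^ s * c ^ (n - s) ≤ (a ^ v * c ^ (1 - v)) ^ n := by
    rw [mul_pow, ← Real.rpow_mul_natCast (by linarith), ← Real.rpow_mul_natCast hc0]
    refine mul_le_mul ?_ ?_ (by positivity) (by positivity)
    · rw [← Real.rpow_natCast]
      exact Real.rpow_le_rpow_of_exponent_le ha1 (by linarith)
    · rcases hc0.eq_or_lt with h | h
      · rw [← h]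
        rcases Nat.eq_zero_or_pos n with hn | hn
        · simp [hn]
        · have hlt : s < n := by
            have hn' : (0 : ℝ) < n := by exact_mod_cast hn
            have : (s : ℝ) < n := hs.trans_lt (by nlinarith)
            exact_mod_cast this
          rw [zero_pow (by omega)]; positivity
      · rw [← Real.rpow_natCast]
        refine Real.rpow_le_rpow_of_exponent_ge h hc1 ?_
        rw [Nat.cast_sub hsn]; linarith
  refine h1.trans (pow_le_pow_left₀ (by positivity) ?_ n)
  have h2 := Real.geom_mean_le_arith_mean2_weighted hv0.le hv1'.le (Real.sqrt_nonneg a)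
    (Real.sqrt_nonneg c) (by ring)
  have h3 : a ^ v * c ^ (1 - v) = (√a ^ v * √c ^ (1 - v)) ^ 2 := by
    rw [mul_pow, ← Real.rpow_mul_natCast (by positivity), ← Real.rpow_mul_natCast (by positivity),
      mul_comm v, mul_comm (1 - v), Real.rpow_mul (by positivity), Real.rpow_mul (by positivity)]
    simp [Real.sq_sqrt hc0, Real.sq_sqrt (by linarith : 0 ≤ a)]
  rw [h3]
  refine (pow_le_pow_left₀ (by positivity) h2 2).trans ?_
  have hva : v * a = u := by rw [ha]; field_simp
  have hvc : (1 - v) * c = 1 - u := by rw [hc]; field_simp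
  have hac : √a * √c = √(a * c) := (Real.sqrt_mul (by linarith) c).symm
  have hsq : (v * √a + (1 - v) * √c) ^ 2 =
      v * u + (1 - v) * (1 - u) + 2 * (v * (1 - v) * √(a * c)) := by
    have : (v * √a + (1 - v) * √c) ^ 2 =
        v * (v * √a ^ 2) + (1 - v) * ((1 - v) * √c ^ 2) + 2 * (v * (1 - v) * (√a * √c)) := by ring
    rw [this, Real.sq_sqrt hc0, Real.sq_sqrt (by linarith : 0 ≤ a), hva, hvc, hac]
  rw [hsq]
  -- With `P = u * (1 - v)` and `Q = v * (1 - u)` one has `√P * √Q ≤ (P + Q - (P - Q) ^ 2) / 2`,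
  -- since `P - Q = u - v` and `(√P + √Q) ^ 2 ≤ 1`.
  set P := u * (1 - v) with hP
  set Q := v * (1 - u) with hQ
  have hP0 : 0 ≤ P := by positivity
  have hQ0 : 0 ≤ Q := by positivity
  have hPQ : v * (1 - v) * √(a * c) = √P * √Q := by
    rw [← Real.sqrt_mul hP0]
    have : P * Q = (v * (1 - v)) ^ 2 * (a * c) := by
      rw [hP, hQ]
      calc u * (1 - v) * (v * (1 - u)) = (v * a) * (1 - v) * (v * ((1 - v) * c)) := by
            rw [hva, hvc]
        _ = _ := by ring
    rw [this, Real.sqrt_mul (sq_nonneg (v * (1 - v))), Real.sqrt_sq (by positivity)]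
  rw [hPQ]
  set r := √P
  set t := √Q
  have hr : r ^ 2 = P := Real.sq_sqrt hP0
  have ht : t ^ 2 = Q := Real.sq_sqrt hQ0
  have hd : (u - v) = (r - t) * (r + t) := by
    have : (r - t) * (r + t) = r ^ 2 - t ^ 2 := by ring
    rw [this, hr, ht, hP, hQ]; ring
  have hle : (r + t) ^ 2 ≤ 1 := by
    have h4 : (r * t) ^ 2 = (u * (1 - u)) * (v * (1 - v)) := by
      rw [mul_pow, hr, ht, hP, hQ]; ring
    have h5 : r * t ≤ (u * (1 - u) + v * (1 - v)) / 2 := by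
      refine abs_le_of_sq_le_sq' ?_ (by positivity) |>.2
      rw [h4]; nlinarith [sq_nonneg (u * (1 - u) - v * (1 - v))]
    have h6 : (r + t) ^ 2 = P + Q + 2 * (r * t) := by rw [← hr, ← ht]; ring
    rw [h6, hP, hQ]; nlinarith [sq_nonneg (u + v - 1), sq_nonneg (u - v)]
  have hd2 : (u - v) ^ 2 ≤ (r - t) ^ 2 := by
    rw [hd, mul_pow]; exact mul_le_of_le_one_right (sq_nonneg _) hle
  have h7 : (r - t) ^ 2 = P + Q - 2 * (r * t) := by rw [← hr, ← ht]; ring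
  rw [h7] at hd2
  rw [hP, hQ] at hd2
  linarith

/-- Chernoff's bound for the lower tail of the binomial law. -/
lemma binCdf_le_of_le {n s : ℕ} {x y : ℝ} (hx : 0 < x) (hxy : x < y) (hy : y ≤ 1) (hs : s ≤ n * x) :
    binCdf n y s ≤ (1 - (y - x) ^ 2) ^ n := by
  have hx1 : x < 1 := by linarith
  have hsn : s ≤ n := by
    have : (s : ℝ) ≤ n := hs.trans (by nlinarith [(Nat.cast_nonneg n : (0 : ℝ) ≤ n)])
    exact_mod_cast this
  refine le_trans ?_ (likelihood_ratio_le hx hxy.le hy hx1 hs)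
  have hR : 0 ≤ (y / x) ^ s * ((1 - y) / (1 - x)) ^ (n - s) := by
    have : 0 ≤ 1 - y := by linarith
    have : 0 ≤ 1 - x := by linarith
    have : 0 ≤ y := by linarith
    positivity
  calc binCdf n y s ≤ ∑ i ∈ Finset.range (s + 1),
        (y / x) ^ s * ((1 - y) / (1 - x)) ^ (n - s) * binWeight n x i := by
        refine Finset.sum_le_sum fun i hi => ?_
        have his : i ≤ s := by simpa [Nat.lt_succ_iff] using hi
        have e : binWeight n y i =
            (y / x) ^ i * ((1 - y) / (1 - x)) ^ (n - i) * binWeight n x i := by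
          have : (1 - x) ≠ 0 := by linarith
          simp only [binWeight, div_pow]; field_simp
        rw [e]
        refine mul_le_mul_of_nonneg_right ?_ (binWeight_nonneg hx.le hx1.le n i)
        have h1 : (y / x) ^ i * ((1 - y) / (1 - x)) ^ (s - i) ≤ (y / x) ^ s := by
          have hge : 1 ≤ y / x := by rw [le_div_iff₀ hx]; linarith
          have hc0 : 0 ≤ (1 - y) / (1 - x) := div_nonneg (by linarith) (by linarith)
          have hc1 : (1 - y) / (1 - x) ≤ 1 := by rw [div_le_one (by linarith)]; linarith
          calc _ ≤ (y / x) ^ i * 1 := by gcongr; exact pow_le_one₀ hc0 hc1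
            _ ≤ _ := by rw [mul_one]; exact pow_le_pow_right₀ hge his
        have hc0 : 0 ≤ (1 - y) / (1 - x) := div_nonneg (by linarith) (by linarith)
        calc _ = (y / x) ^ i * ((1 - y) / (1 - x)) ^ (s - i) *
              ((1 - y) / (1 - x)) ^ (n - s) := by
              rw [mul_assoc, ← pow_add]; congr 2; omega
          _ ≤ _ := by gcongr
    _ = (y / x) ^ s * ((1 - y) / (1 - x)) ^ (n - s) * binCdf n x s := by
        rw [← Finset.mul_sum, binCdf]
    _ ≤ _ := mul_le_of_le_one_right hR (binCdf_le_one hx.le hx1.le n s)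

/-! ### The inverse of the binomial distribution function below the mean -/

lemma binWeight_succ_mul {n s : ℕ} (h : s < n) (p : ℝ) :
    binWeight n p (s + 1) * ((s + 1) * (1 - p)) = binWeight n p s * ((n - s) * p) := by
  have hc : (n.choose (s + 1) : ℝ) * (s + 1) = n.choose s * (n - s) := by
    have := Nat.choose_succ_right_eq n s
    rw [← Nat.cast_sub h.le]
    exact_mod_cast this
  obtain ⟨k, rfl⟩ := Nat.exists_eq_add_of_lt h
  have e1 : s + k + 1 - s = k + 1 := by omega
  have e2 : s + k + 1 - (s + 1) = k := by omega
  simp only [binWeight, e1, e2]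
  calc _ = (((s + k + 1).choose (s + 1) : ℝ) * (s + 1)) * (p ^ (s + 1) * (1 - p) ^ (k + 1)) := by
        ring
    _ = _ := by rw [hc]; ring

/-- A bound for the reversed hazard rate `binWeight n p s / binCdf n p s` of the binomial law below
its mean: up to the correction `d`, of the order of the standard deviation, it is
`1 - binWeight n p (s - 1) / binWeight n p s`. -/
lemma binWeight_mul_le_binCdf {n : ℕ} {p d : ℝ} (hp0 : 0 < p) (hp1 : p < 1) (hd : 0 ≤ d)
    (hd2 : (n + 1) * p * (1 - p) ≤ d ^ 2) {s : ℕ} (hsn : s ≤ n) (hs : s ≤ (n + 1) * p) :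
    binWeight n p s * ((n + 1 - s) * p) ≤ ((n + 1) * p - s + d) * binCdf n p s := by
  induction s with
  | zero =>
    have h0 := binWeight_nonneg hp0.le hp1.le n 0
    simp only [binCdf, zero_add, Finset.sum_range_one, Nat.cast_zero, sub_zero]
    nlinarith
  | succ s ih =>
    have hsn' : s < n := hsn
    have hcast : ((s + 1 : ℕ) : ℝ) = s + 1 := by push_cast; ring
    rw [hcast] at hs ⊢
    have ih := ih hsn'.le (by linarith)
    have hrel := binWeight_succ_mul hsn' p
    have hb := binWeight_nonneg hp0.le hp1.le n s
    have hF := binCdf_nonneg hp0.le hp1.le n s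
    rw [binCdf_succ]
    set b := binWeight n p s
    set b' := binWeight n p (s + 1)
    set F := binCdf n p s
    have hw : (0 : ℝ) < n - s := by
      have : (s : ℝ) < n := by exact_mod_cast hsn'
      linarith
    set w : ℝ := n - s with hwdef
    set G : ℝ := (n + 1) * p - (s + 1) + d with hG
    have hG0 : d ≤ G := by linarith
    have hS : 0 < ((s : ℝ) + 1) * (1 - p) := mul_pos (by positivity) (by linarith)
    have hSw : ((s : ℝ) + 1) * (1 - p) ≤ w * p := by
      rw [hwdef]; nlinarith
    have ih' : b * ((w + 1) * p) ≤ (G + 1) * F := by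
      refine (le_of_eq ?_).trans (ih.trans (le_of_eq ?_)) <;> · simp only [hwdef, hG]; ring
    have hmain : (w - G) * (((s : ℝ) + 1) * (1 - p)) ≤ d * (G + 1) * w := by
      rcases le_or_gt (w - G) 0 with h | h
      · exact (mul_nonpos_of_nonpos_of_nonneg h hS.le).trans
          (mul_nonneg (mul_nonneg hd (by linarith)) hw.le)
      · have e : w - G = (n + 1) * (1 - p) - d := by simp only [hwdef, hG]; ring
        calc _ ≤ (w - G) * (w * p) := by gcongr
          _ ≤ ((n + 1) * (1 - p)) * (w * p) := by
              have : 0 ≤ w * p := by positivity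
              gcongr; linarith
          _ = ((n + 1) * p * (1 - p)) * w := by ring
          _ ≤ d ^ 2 * w := by gcongr
          _ ≤ d * (G + 1) * w := by rw [sq]; gcongr; linarith
    have h1 : b * p * (w - G) ≤ d * (G + 1) * b' := by
      refine le_of_mul_le_mul_right ?_ hS
      calc b * p * (w - G) * (((s : ℝ) + 1) * (1 - p))
          = b * p * ((w - G) * (((s : ℝ) + 1) * (1 - p))) := by ring
        _ ≤ b * p * (d * (G + 1) * w) := by gcongr
        _ = d * (G + 1) * (b * (w * p)) := by ring
        _ = _ := by rw [← hrel]; ring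
    have h2 : (G + 1) * (b' * (w * p)) ≤ (G + 1) * (G * (F + b')) := by
      have e3 : w * p - G = ((s : ℝ) + 1) * (1 - p) - d := by simp only [hwdef, hG]; ring
      have h3 : G * (b * ((w + 1) * p)) ≤ G * ((G + 1) * F) := by gcongr
      have h4 : b' * (w * p) = G * b' + b * (w * p) - d * b' := by
        rw [← hrel]; linear_combination b' * e3
      rw [h4]
      nlinarith
    have h5 := le_of_mul_le_mul_left h2 (by linarith)
    refine (le_of_eq ?_).trans h5
    simp only [hwdef]; ring

/-- Passing from `n` trials of success probability `u` to `n + 1` trials of success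
probability `v`. -/
lemma binWeight_mul_eq_ratio {n s : ℕ} (hs : s ≤ n) {u v : ℝ} (hv0 : v ≠ 0) (hv1 : v ≠ 1) :
    binWeight n u s * ((n + 1) * (1 - v)) = (n + 1 - s) *
      ((u / v) ^ s * ((1 - u) / (1 - v)) ^ (n - s)) * binWeight (n + 1) v s := by
  have hv1' : 1 - v ≠ 0 := sub_ne_zero.2 hv1.symm
  have hc : (n.choose s : ℝ) * (n + 1) = (n + 1).choose s * (n + 1 - s) := by
    have := Nat.choose_mul_succ_eq n s
    have e : ((n + 1 - s : ℕ) : ℝ) = n + 1 - s := by rw [Nat.cast_sub (by omega)]; push_cast; ring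
    rw [← e]; exact_mod_cast this
  have e1 : n + 1 - s = (n - s) + 1 := by omega
  simp only [binWeight, e1, div_pow, pow_succ]
  field_simp
  linear_combination u ^ s * (1 - u) ^ (n - s) * hc

lemma sum_pow_mul_le {q c : ℝ} (hq0 : 0 ≤ q) (hq1 : q < 1) (hc : 0 ≤ c) (m : ℕ) :
    ∑ i ∈ Finset.range m, q ^ i * (i + 1 + c) ≤ (1 / (1 - q)) ^ 2 + c * (1 / (1 - q)) := by
  have hq : 0 < 1 - q := by linarith
  have hg : ∀ m : ℕ, ∑ i ∈ Finset.range m, q ^ i ≤ 1 / (1 - q) := fun m => by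
    rw [one_div, ← tsum_geometric_of_lt_one hq0 hq1]
    exact (summable_geometric_of_lt_one hq0 hq1).sum_le_tsum _ fun i _ => by positivity
  have h2 : ∀ m : ℕ, ∑ i ∈ Finset.range m, q ^ i * ((i : ℝ) + 1) ≤ (1 / (1 - q)) ^ 2 := fun m => by
    have e : (1 - q) * ∑ i ∈ Finset.range m, q ^ i * ((i : ℝ) + 1) =
        ∑ i ∈ Finset.range m, q ^ i - m * q ^ m := by
      induction m with
      | zero => simp
      | succ m ih => rw [Finset.sum_range_succ, Finset.sum_range_succ, mul_add, ih]; push_cast; ring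
    have h : (1 - q) * ∑ i ∈ Finset.range m, q ^ i * ((i : ℝ) + 1) ≤ 1 / (1 - q) := by
      rw [e]
      have : 0 ≤ (m : ℝ) * q ^ m := by positivity
      linarith [hg m]
    rw [sq]
    calc _ = 1 / (1 - q) * ((1 - q) * ∑ i ∈ Finset.range m, q ^ i * ((i : ℝ) + 1)) := by
          field_simp
      _ ≤ _ := by gcongr
  have e : ∑ i ∈ Finset.range m, q ^ i * ((i : ℝ) + 1 + c) =
      ∑ i ∈ Finset.range m, q ^ i * ((i : ℝ) + 1) + c * ∑ i ∈ Finset.range m, q ^ i := by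
    rw [Finset.mul_sum, ← Finset.sum_add_distrib]
    exact Finset.sum_congr rfl fun i _ => by ring
  rw [e]
  exact add_le_add (h2 m) (mul_le_mul_of_nonneg_left (hg m) hc)

/-- The standard deviation of a binomial law, of order `√n`, is reduced to `1 / e` by the
exponential factor of `likelihood_ratio_le`. -/
lemma pow_mul_sqrt_le {e v : ℝ} (he : 0 < e) (he1 : e ≤ 1) (hv0 : 0 ≤ v) (hv1 : v ≤ 1) (n : ℕ) :
    (1 - e ^ 2) ^ n * √((n + 2) * v * (1 - v)) ≤ 1 / e := by
  have hv1' : 0 ≤ 1 - v := by linarith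
  set d := √((n + 2) * v * (1 - v)) with hd
  have hd0 : 0 ≤ d := Real.sqrt_nonneg _
  have hd2 : d ^ 2 = (n + 2) * v * (1 - v) := Real.sq_sqrt (by positivity)
  have he2 : e ^ 2 ≤ 1 := pow_le_one₀ he.le he1
  have hr0 : 0 ≤ (1 - e ^ 2) ^ n := pow_nonneg (by linarith) n
  have hbern : (1 - e ^ 2) ^ n * (1 + n * e ^ 2) ≤ 1 := by
    have h1 : 1 + n * e ^ 2 ≤ (1 + e ^ 2) ^ n :=
      one_add_mul_le_pow (by linarith [sq_nonneg e]) n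
    calc (1 - e ^ 2) ^ n * (1 + n * e ^ 2) ≤ (1 - e ^ 2) ^ n * (1 + e ^ 2) ^ n := by gcongr
      _ = (1 - e ^ 4) ^ n := by rw [← mul_pow]; ring
      _ ≤ 1 := by
          have he4 : e ^ 4 ≤ 1 := pow_le_one₀ he.le he1
          exact pow_le_one₀ (by linarith) (by linarith [pow_nonneg he.le 4])
  have hde : d * e ≤ 1 + n * e ^ 2 := by
    have hvv : v * (1 - v) ≤ 1 / 4 := by nlinarith [sq_nonneg (v - 1 / 2)]
    have h4 : d ^ 2 * e ^ 2 ≤ (n + 2) * (1 / 4) * e ^ 2 := by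
      rw [hd2, mul_assoc (n + 2 : ℝ)]; gcongr
    have h3 : 0 ≤ (d * e - 1) ^ 2 := sq_nonneg _
    have h5 : 0 ≤ n * e ^ 2 := by positivity
    linarith
  rw [le_div_iff₀ he, mul_assoc]
  exact (mul_le_mul_of_nonneg_left hde hr0).trans hbern

/-- The part of the inverse moment that comes from unusually few successes. With `e` the distance
of the two probabilities, the reversed hazard rate and the geometric decay of the likelihood ratio
give a bound of order `1 / (n * e ^ 2)`, while estimating `binCdf (n + 1) (u - e) s` from below by
the weight of `s` alone would only give `1 / e`. -/
lemma sum_binWeight_div_binCdf_le {n : ℕ} {u e : ℝ} (he : 0 < e) (heu : 4 * e ≤ u) (hu : u ≤ 1) :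
    ∑ s ∈ Finset.range (⌊n * (u - e)⌋₊ + 1), binWeight n u s / binCdf (n + 1) (u - e) s ≤
      6 / ((n + 1) * e ^ 2) := by
  set v := u - e with hv
  have hv0 : 0 < v := by linarith
  have hv1 : v < 1 := by linarith
  have hv1' : 0 < 1 - v := by linarith
  have hu0 : 0 < u := by linarith
  have hu1' : 0 ≤ 1 - u := by linarith
  have hn0 : (0 : ℝ) ≤ n := Nat.cast_nonneg n
  have huv : u ≤ 4 / 3 * v := by linarith
  have he1 : e ≤ 1 := by linarith
  set m := ⌊n * v⌋₊ with hm
  have hmle : (m : ℝ) ≤ n * v := Nat.floor_le (by positivity)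
  have hmlt : n * v < m + 1 := Nat.lt_floor_add_one _
  have hmn : m ≤ n := by
    have : (m : ℝ) ≤ n := hmle.trans (by nlinarith)
    exact_mod_cast this
  set d := √((n + 2) * v * (1 - v)) with hd
  have hd0 : 0 ≤ d := Real.sqrt_nonneg _
  have hd2 : d ^ 2 = (n + 2) * v * (1 - v) := Real.sq_sqrt (by positivity)
  set r : ℝ := (u / v) ^ m * ((1 - u) / (1 - v)) ^ (n - m) with hr
  have hr0 : 0 ≤ r := by positivity
  have hre : r ≤ (1 - e ^ 2) ^ n := by
    have := likelihood_ratio_le hv0 (by linarith) hu hv1 hmle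
    rwa [show u - v = e by rw [hv]; ring] at this
  set q := v * (1 - u) / (u * (1 - v)) with hq
  have hq0 : 0 ≤ q := by positivity
  have hq1 : 1 - q = e / (u * (1 - v)) := by
    rw [hq, hv]; rw [hv] at hv1'; field_simp; ring
  have hqlt : q < 1 := by
    have : 0 < e / (u * (1 - v)) := by positivity
    linarith
  set B : ℝ := (n + 1) * v * (1 - v) with hB
  have hB0 : 0 < B := by positivity
  -- The summand at `m - i`.
  have hterm : ∀ i ∈ Finset.range (m + 1), binWeight n u (m - i) / binCdf (n + 1) v (m - i) ≤
      r / B * (q ^ i * (i + 1 + (2 + d))) := by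
    intro i hi
    have him : i ≤ m := by simpa [Nat.lt_succ_iff] using hi
    obtain ⟨s, hs⟩ := Nat.exists_eq_add_of_le' him
    rw [hs, Nat.add_sub_cancel]
    have hsn : s ≤ n := by omega
    have hms : (m : ℝ) = s + i := by exact_mod_cast hs
    have hF := binCdf_pos hv0.le hv1 (n + 1) s
    have hsm : (s : ℝ) ≤ n * v := by
      have : (0 : ℝ) ≤ i := Nat.cast_nonneg i
      linarith
    have haz := binWeight_mul_le_binCdf (n := n + 1) hv0 hv1 hd0
      (by rw [hd2]; push_cast; apply le_of_eq; ring) (s := s) (by omega)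
      (by push_cast; nlinarith)
    have hrat := binWeight_mul_eq_ratio hsn (u := u) hv0.ne' hv1.ne
    have hrs : (u / v) ^ s * ((1 - u) / (1 - v)) ^ (n - s) = r * q ^ i := by
      have e1 : n - s = (n - m) + i := by omega
      rw [hr, hq, e1, hs, pow_add, pow_add]
      have : (u / v) ^ i * (v * (1 - u) / (u * (1 - v))) ^ i = ((1 - u) / (1 - v)) ^ i := by
        rw [← mul_pow]; congr 1; field_simp
      rw [← this]; ring
    rw [hrs] at hrat
    have hsn' : (s : ℝ) ≤ n := by exact_mod_cast hsn
    rw [div_le_iff₀ hF]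
    have hw : (0 : ℝ) < (n + 1 : ℕ) + 1 - s := by push_cast; linarith
    have hbw := binWeight_nonneg hv0.le hv1.le (n + 1) s
    have hrq : 0 ≤ r * q ^ i := by positivity
    have h1 : binWeight n u s * B ≤ r * q ^ i * (((n + 1 : ℕ) + 1) * v - s + d) *
        binCdf (n + 1) v s := by
      calc binWeight n u s * B = (binWeight n u s * ((n + 1) * (1 - v))) * v := by rw [hB]; ring
        _ = (n + 1 - s) * (r * q ^ i * (binWeight (n + 1) v s * v)) := by rw [hrat]; ring
        _ ≤ ((n + 1 : ℕ) + 1 - s) * (r * q ^ i * (binWeight (n + 1) v s * v)) := by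
            refine mul_le_mul_of_nonneg_right ?_ (by positivity)
            push_cast; linarith
        _ = r * q ^ i * (binWeight (n + 1) v s * (((n + 1 : ℕ) + 1 - s) * v)) := by ring
        _ ≤ r * q ^ i * ((((n + 1 : ℕ) + 1) * v - s + d) * binCdf (n + 1) v s) := by gcongr
        _ = _ := by ring
    have h2 : binWeight n u s * B ≤ r * q ^ i * (i + 1 + (2 + d)) * binCdf (n + 1) v s := by
      refine h1.trans (mul_le_mul_of_nonneg_right (mul_le_mul_of_nonneg_left ?_ hrq) hF.le)
      push_cast; linarith
    calc binWeight n u s = binWeight n u s * B / B := by field_simp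
      _ ≤ r * q ^ i * (i + 1 + (2 + d)) * binCdf (n + 1) v s / B := by gcongr
      _ = _ := by ring
  rw [← Finset.sum_range_reflect]
  have hcongr : ∀ i ∈ Finset.range (m + 1), binWeight n u (m + 1 - 1 - i) /
      binCdf (n + 1) v (m + 1 - 1 - i) ≤ r / B * (q ^ i * (i + 1 + (2 + d))) := by
    simpa using hterm
  refine (Finset.sum_le_sum hcongr).trans ?_
  rw [← Finset.mul_sum]
  refine (mul_le_mul_of_nonneg_left (sum_pow_mul_le hq0 hqlt (by positivity) _)
    (by positivity)).trans ?_
  have hinv : 1 / (1 - q) = u * (1 - v) / e := by rw [hq1]; field_simp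
  rw [hinv]
  have he2 : e ^ 2 ≤ 1 := pow_le_one₀ he.le he1
  have hr1 : r ≤ 1 := hre.trans (pow_le_one₀ (by linarith) (by linarith [sq_nonneg e]))
  have hrd : r * d ≤ 1 / e :=
    (mul_le_mul_of_nonneg_right hre hd0).trans (pow_mul_sqrt_le he he1 hv0.le hv1.le n)
  have e1 : r / B * ((u * (1 - v) / e) ^ 2 + (2 + d) * (u * (1 - v) / e)) =
      (u / v) * ((r * u * (1 - v)) + (2 * r + r * d) * e) / ((n + 1) * e ^ 2) := by
    rw [hB]; field_simp
  rw [e1]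
  gcongr
  have huv' : u / v ≤ 4 / 3 := by rw [div_le_iff₀ hv0]; exact huv
  have h5 : r * u * (1 - v) ≤ 1 := by
    have : u * (1 - v) ≤ 1 := mul_le_one₀ hu hv1'.le (by linarith)
    calc r * u * (1 - v) = r * (u * (1 - v)) := by ring
      _ ≤ 1 * 1 := by gcongr
      _ = 1 := by ring
  have h6 : (2 * r + r * d) * e ≤ 3 := by
    have : r * d * e ≤ 1 := by rwa [le_div_iff₀ he] at hrd
    have : r * e ≤ 1 := mul_le_one₀ hr1 he.le he1
    linarith
  calc u / v * ((r * u * (1 - v)) + (2 * r + r * d) * e) ≤ 4 / 3 * (1 + 3) := by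
        gcongr
    _ ≤ 6 := by norm_num

/-- The expected odds against exceeding `u - e` of a posterior sample, when the posterior is based
on `n` trials of success probability `u`: the sample exceeds `u - e` with probability
`binCdf (n + 1) (u - e) s` after `s` successes. -/
lemma sum_binWeight_odds_le {n : ℕ} {u e : ℝ} (he : 0 < e) (heu : 2 * e ≤ u) (hu : u ≤ 1) :
    ∑ s ∈ Finset.range (n + 1), binWeight n u s * (1 / binCdf (n + 1) (u - e) s - 1) ≤
      25 / ((n + 1) * e ^ 2) := by
  -- Few successes are treated with the larger threshold `v`, for which they lie below the mean;
  -- for the others Cantelli's inequality suffices.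
  set v := u - e / 2 with hv
  have hu0 : 0 ≤ u := by linarith
  have hv0 : 0 ≤ v := by linarith
  have hv1 : v < 1 := by linarith
  have hy0 : 0 ≤ u - e := by linarith
  have hy1 : u - e < 1 := by linarith
  set m := ⌊n * v⌋₊ with hm
  have hmn : m ≤ n := by
    have h1 : (m : ℝ) ≤ n * v := Nat.floor_le (by positivity)
    have : (m : ℝ) ≤ n := h1.trans (by nlinarith [(Nat.cast_nonneg n : (0 : ℝ) ≤ n)])
    exact_mod_cast this
  have hpos : (0 : ℝ) < n + 1 := by positivity
  have hterm : ∀ s ∈ Finset.range (n + 1), binWeight n u s * (1 / binCdf (n + 1) (u - e) s - 1) ≤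
      (if s ∈ Finset.range (m + 1) then binWeight n u s / binCdf (n + 1) v s else 0) +
        binWeight n u s * (1 / ((n + 1) * e ^ 2)) := by
    intro s _
    have hb := binWeight_nonneg hu0 hu n s
    have hF := binCdf_pos hy0 hy1 (n + 1) s
    have hFv := binCdf_pos hv0 hv1 (n + 1) s
    split_ifs with hs
    · have hanti : binCdf (n + 1) v s ≤ binCdf (n + 1) (u - e) s :=
        binCdf_antitoneOn n s ⟨hy0, hy1.le⟩ ⟨hv0, hv1.le⟩ (by linarith)
      have h1 : 1 / binCdf (n + 1) (u - e) s ≤ 1 / binCdf (n + 1) v s :=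
        one_div_le_one_div_of_le hFv hanti
      have h2 : binWeight n u s * (1 / binCdf (n + 1) (u - e) s - 1) ≤
          binWeight n u s * (1 / binCdf (n + 1) v s) := by gcongr; linarith
      have h3 : 0 ≤ binWeight n u s * (1 / ((n + 1) * e ^ 2)) := by positivity
      rw [mul_one_div] at h2
      linarith
    · rw [zero_add]
      refine mul_le_mul_of_nonneg_left ?_ hb
      have hms : n * v < s := by
        have : m < s := by simpa [Nat.lt_succ_iff] using hs
        exact (Nat.floor_lt (by positivity)).1 this
      refine (one_div_binCdf_sub_one_le (n := n + 1) (a := (n + 1) * (e / 2)) hy0 hy1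
        (by positivity) ?_).trans ?_
      · push_cast
        have : ((n : ℝ) + 1) * (u - e) + (n + 1) * (e / 2) = n * v + v := by rw [hv]; ring
        linarith
      · have h4 : ((n + 1 : ℕ) : ℝ) * (u - e) * (1 - (u - e)) ≤ (n + 1) * (1 / 4) := by
          push_cast
          rw [mul_assoc]
          gcongr
          nlinarith [sq_nonneg (u - e - 1 / 2)]
        refine (div_le_div_of_nonneg_right h4 (by positivity)).trans (le_of_eq ?_)
        field_simp
        norm_num
  refine (Finset.sum_le_sum hterm).trans ?_
  rw [Finset.sum_add_distrib, ← Finset.sum_mul, sum_binWeight, Finset.sum_ite_mem,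
    Finset.inter_eq_right.2 (Finset.range_subset_range.2 (by omega))]
  have h := sum_binWeight_div_binCdf_le (n := n) (u := u) (e := e / 2) (by linarith)
    (by linarith) hu
  have e2 : 6 / (((n : ℝ) + 1) * (e / 2) ^ 2) = 24 / ((n + 1) * e ^ 2) := by field_simp; norm_num
  rw [e2] at h
  have e3 : 25 / (((n : ℝ) + 1) * e ^ 2) =
      24 / ((n + 1) * e ^ 2) + 1 * (1 / ((n + 1) * e ^ 2)) := by
    ring
  rw [e3]
  gcongr

/-! ### Tails of Beta distributions with integer parameters -/

lemma binCdf_eq_zero_of_one {n s : ℕ} (h : s < n) : binCdf n 1 s = 0 := by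
  refine Finset.sum_eq_zero fun i hi => ?_
  have : i ≤ s := by simpa [Nat.lt_succ_iff] using hi
  simp [binWeight, zero_pow (show n - i ≠ 0 by omega)]

lemma betaPDF_natCast {s r : ℕ} {x : ℝ} (h0 : 0 < x) (h1 : x < 1) :
    betaPDF ((1 + s : ℕ) : ℝ) ((1 + r : ℕ) : ℝ) x =
      ENNReal.ofReal (((s + r : ℕ) + 1) * binWeight (s + r) x s) := by
  rw [betaPDF_of_pos_lt_one h0 h1]
  congr 1
  have e1 : ((1 + s : ℕ) : ℝ) - 1 = s := by push_cast; ring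
  have e2 : ((1 + r : ℕ) : ℝ) - 1 = r := by push_cast; ring
  have hb : 1 / beta ((1 + s : ℕ) : ℝ) ((1 + r : ℕ) : ℝ) =
      ((s + r : ℕ) + 1) * (s + r).choose s := by
    have e3 : ((1 + s : ℕ) : ℝ) + ((1 + r : ℕ) : ℝ) = ((s + r + 1 : ℕ) : ℝ) + 1 := by
      push_cast; ring
    have e4 : ((1 + s : ℕ) : ℝ) = s + 1 := by push_cast; ring
    have e5 : ((1 + r : ℕ) : ℝ) = r + 1 := by push_cast; ring
    rw [beta, e3, e4, e5, Real.Gamma_nat_eq_factorial, Real.Gamma_nat_eq_factorial,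
      Real.Gamma_nat_eq_factorial, Nat.factorial_succ, ← Nat.add_choose_mul_factorial_mul_factorial]
    have : ((s.factorial : ℕ) : ℝ) ≠ 0 := by exact_mod_cast s.factorial_ne_zero
    have : ((r.factorial : ℕ) : ℝ) ≠ 0 := by exact_mod_cast r.factorial_ne_zero
    rw [Nat.choose_symm_add]
    push_cast
    field_simp
  rw [hb, e1, e2, Real.rpow_natCast, Real.rpow_natCast, binWeight, Nat.add_sub_cancel_left]
  ring

lemma integral_binWeight (n s : ℕ) (hs : s ≤ n) (y : ℝ) :
    ∫ x in y..1, ((n : ℝ) + 1) * binWeight n x s = binCdf (n + 1) y s := by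
  have h := intervalIntegral.integral_eq_sub_of_hasDerivAt (a := y) (b := 1)
    (fun x _ => hasDerivAt_binCdf n s x)
    (by
      refine Continuous.intervalIntegrable ?_ _ _
      unfold binWeight; fun_prop)
  rw [intervalIntegral.integral_neg, binCdf_eq_zero_of_one (Nat.lt_succ_of_le hs)] at h
  linarith

/-- A Beta variable with integer parameters is an order statistic of uniform variables, so that
its tail is a binomial probability. -/
lemma betaMeasure_real_Ioi (s r : ℕ) {y : ℝ} (h0 : 0 ≤ y) (h1 : y ≤ 1) :
    (betaMeasure ((1 + s : ℕ) : ℝ) ((1 + r : ℕ) : ℝ)).real (Set.Ioi y) =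
      binCdf (s + r + 1) y s := by
  have hnn : ∀ x ∈ Set.Ioc y 1, 0 ≤ ((s + r : ℕ) + 1 : ℝ) * binWeight (s + r) x s := fun x hx =>
    mul_nonneg (by positivity) (binWeight_nonneg (h0.trans hx.1.le) hx.2 _ _)
  have hcont : Continuous fun x : ℝ => ((s + r : ℕ) + 1 : ℝ) * binWeight (s + r) x s := by
    unfold binWeight; fun_prop
  rw [measureReal_def, betaMeasure, withDensity_apply _ measurableSet_Ioi,
    ← Set.Ioc_union_Ioi_eq_Ioi h1, lintegral_union measurableSet_Ioi
      (Set.Ioc_disjoint_Ioi le_rfl),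
    setLIntegral_eq_zero measurableSet_Ioi
      (fun x hx => betaPDF_eq_zero_of_one_le (le_of_lt hx)), add_zero,
    ← restrict_Ioo_eq_restrict_Ioc,
    setLIntegral_congr_fun measurableSet_Ioo
      (fun x hx => betaPDF_natCast (h0.trans_lt hx.1) hx.2),
    restrict_Ioo_eq_restrict_Ioc,
    ← integral_eq_lintegral_of_nonneg_ae
      (ae_restrict_of_forall_mem measurableSet_Ioc hnn) hcont.aestronglyMeasurable,
    ← intervalIntegral.integral_of_le h1, integral_binWeight _ _ (Nat.le_add_right s r)]

/-! ### The choice of an arm from independent samples -/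

lemma le_argmax {D : ℕ} [NeZero D] (θ : Fin D → ℝ) (e : Fin D) : θ e ≤ θ (argmax θ) := by
  classical
  have : argmax θ ∈ Finset.univ.filter fun d => ∀ e, θ e ≤ θ d := by
    unfold argmax
    convert! Finset.min'_mem _ _
  simp only [Finset.mem_filter, Finset.mem_univ, true_and] at this
  exact this e

lemma argmax_eq_iff {D : ℕ} [NeZero D] (θ : Fin D → ℝ) (d : Fin D) :
    argmax θ = d ↔ (∀ e, θ e ≤ θ d) ∧ ∀ d' < d, ∃ e, θ d' < θ e := by
  classical
  constructor
  · rintro rfl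
    refine ⟨le_argmax θ, fun d' hd' => ?_⟩
    by_contra! h
    refine absurd hd' (not_lt.2 ?_)
    unfold argmax
    exact Finset.min'_le _ _ (by simpa using h)
  · rintro ⟨h1, h2⟩
    refine le_antisymm ?_ ?_
    · unfold argmax
      exact Finset.min'_le _ _ (by simpa using h1)
    · by_contra! h
      obtain ⟨e, he⟩ := h2 _ h
      exact absurd (le_argmax θ e) (not_le.2 he)

lemma argmax_eq_of_lt {D : ℕ} [NeZero D] {θ : Fin D → ℝ} {c : Fin D} {y : ℝ} (hc : y < θ c)
    (h : ∀ e, e ≠ c → θ e ≤ y) : argmax θ = c := by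
  by_contra hne
  exact absurd ((le_argmax θ c).trans (h _ hne)) (not_le.2 hc)

lemma measurable_argmax {D : ℕ} [NeZero D] : Measurable (argmax : (Fin D → ℝ) → Fin D) := by
  refine measurable_to_countable' fun d => ?_
  have : argmax ⁻¹' {d} = {θ : Fin D → ℝ | (∀ e, θ e ≤ θ d) ∧ ∀ d' < d, ∃ e, θ d' < θ e} := by
    ext θ; simp [argmax_eq_iff]
  rw [this]
  have h1 : ∀ e : Fin D, MeasurableSet {θ : Fin D → ℝ | θ e ≤ θ d} := fun e =>
    measurableSet_le (measurable_pi_apply e) (measurable_pi_apply d)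
  have h2 : ∀ d' e : Fin D, MeasurableSet {θ : Fin D → ℝ | θ d' < θ e} := fun d' e =>
    measurableSet_lt (measurable_pi_apply d') (measurable_pi_apply e)
  simp only [Set.ofPred_and, Set.ofPred_forall, Set.ofPred_exists]
  exact (MeasurableSet.iInter h1).inter
    (MeasurableSet.iInter fun d' => MeasurableSet.iInter fun _ =>
      MeasurableSet.iUnion fun e => h2 d' e)

/-- If arm `d` is chosen with a sample at most `y`, then no sample exceeds `y`; and arm `c` is
chosen whenever its sample alone exceeds `y`. By independence the probabilities of these two events differ
by the factor of the odds against the sample of `c` exceeding `y`. -/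
lemma pi_argmax_real_le {D : ℕ} [NeZero D] (ν : Fin D → Measure ℝ) [∀ d, IsProbabilityMeasure (ν d)]
    (c d : Fin D) {y : ℝ} (hp : 0 < (ν c).real (Set.Ioi y)) :
    ((Measure.pi ν).map argmax).real {d} ≤
      (1 / (ν c).real (Set.Ioi y) - 1) * ((Measure.pi ν).map argmax).real {c} +
        (ν d).real (Set.Ioi y) := by
  set p := (ν c).real (Set.Ioi y) with hpdef
  rw [map_measureReal_apply measurable_argmax (measurableSet_singleton d),
    map_measureReal_apply measurable_argmax (measurableSet_singleton c)]
  set Q := ∏ e ∈ Finset.univ.erase c, (ν e).real (Set.Iic y) with hQ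
  have hsub : argmax ⁻¹' {d} ⊆ (Set.univ.pi fun _ : Fin D => Set.Iic y) ∪
      (Function.eval d) ⁻¹' Set.Ioi y := by
    intro θ hθ
    have hθ' : argmax θ = d := hθ
    rcases le_or_gt (θ d) y with h | h
    · left
      intro e _
      exact ((le_argmax θ e).trans (by rw [hθ'])).trans h
    · right; exact h
  have hIic : (ν c).real (Set.Iic y) = 1 - p := by
    have := probReal_compl_eq_one_sub (μ := ν c) (s := Set.Ioi y) measurableSet_Ioi
    rwa [Set.compl_Ioi] at this
  have hbox1 : (Measure.pi ν).real (Set.univ.pi fun _ : Fin D => Set.Iic y) = (1 - p) * Q := by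
    rw [measureReal_def, Measure.pi_pi, ENNReal.toReal_prod,
      ← Finset.mul_prod_erase _ _ (Finset.mem_univ c), ← hIic]
    rfl
  have hbox2 : (Measure.pi ν).real
      (Set.univ.pi fun e : Fin D => if e = c then Set.Ioi y else Set.Iic y) = p * Q := by
    rw [measureReal_def, Measure.pi_pi, ENNReal.toReal_prod,
      ← Finset.mul_prod_erase _ _ (Finset.mem_univ c), if_pos rfl, hpdef, hQ]
    congr 1
    refine Finset.prod_congr rfl fun e he => ?_
    rw [if_neg (Finset.ne_of_mem_erase he)]; rfl
  have hsub2 : (Set.univ.pi fun e : Fin D => if e = c then Set.Ioi y else Set.Iic y) ⊆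
      argmax ⁻¹' {c} := by
    intro θ hθ
    refine argmax_eq_of_lt (y := y) (by simpa using hθ c (Set.mem_univ c)) fun e he => ?_
    have := hθ e (Set.mem_univ e)
    simpa [he] using this
  have hc := measureReal_mono (μ := Measure.pi ν) hsub2
  rw [hbox2] at hc
  have hd := (measureReal_mono (μ := Measure.pi ν) hsub).trans (measureReal_union_le _ _)
  have heval : (Measure.pi ν).real (Function.eval d ⁻¹' Set.Ioi y) = (ν d).real (Set.Ioi y) :=
    (measurePreserving_eval ν d).measureReal_preimage measurableSet_Ioi.nullMeasurableSet
  rw [hbox1, heval] at hd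
  refine hd.trans (add_le_add_left ?_ _)
  have hp1 : p ≤ 1 := measureReal_le_one
  have hodds : 0 ≤ 1 / p - 1 := by rw [sub_nonneg, le_div_iff₀ hp]; linarith
  calc (1 - p) * Q = (1 / p - 1) * (p * Q) := by field_simp
    _ ≤ _ := by gcongr

/-! ### The state of an arm -/

/-- The number of blocks in which arm `d` was used. -/
def pulls {D T k : ℕ} (h : Fin k → Record D T) (d : Fin D) : ℕ := ∑ j, if (h j).1 = d then 1 else 0

/-- The number of successful slots in the blocks in which arm `d` was used. -/
def armSuccesses {D T k : ℕ} (h : Fin k → Record D T) (d : Fin D) : ℕ :=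
  ∑ j, if (h j).1 = d then successes (h j).2 else 0

lemma successes_le {T : ℕ} (s : Fin T → Bool) : successes s ≤ T :=
  (Finset.card_le_univ _).trans (by simp)

lemma betaA_eq {D T k : ℕ} (h : Fin k → Record D T) (d : Fin D) :
    betaA h d = 1 + armSuccesses h d := rfl

lemma betaB_eq {D T k : ℕ} (h : Fin k → Record D T) (d : Fin D) :
    betaB h d = 1 + (pulls h d * T - armSuccesses h d) := by
  have : armSuccesses h d + (∑ j, if (h j).1 = d then T - successes (h j).2 else 0) =
      pulls h d * T := by
    rw [armSuccesses, pulls, ← Finset.sum_add_distrib, Finset.sum_mul]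
    refine Finset.sum_congr rfl fun j _ => ?_
    have := successes_le (h j).2
    split_ifs <;> omega
  rw [betaB]; omega

lemma armSuccesses_le {D T k : ℕ} (h : Fin k → Record D T) (d : Fin D) :
    armSuccesses h d ≤ pulls h d * T := by
  rw [armSuccesses, pulls, Finset.sum_mul]
  refine Finset.sum_le_sum fun j _ => ?_
  have := successes_le (h j).2
  split_ifs <;> omega

instance isProbabilityMeasure_posterior {D T k : ℕ} (h : Fin k → Record D T) (d : Fin D) :
    IsProbabilityMeasure (betaMeasure (betaA h d) (betaB h d)) :=
  isProbabilityMeasureBeta (by rw [betaA_eq]; positivity) (by rw [betaB_eq]; positivity)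

instance isProbabilityMeasure_armLaw {D T k : ℕ} [NeZero D] (h : Fin k → Record D T) :
    IsProbabilityMeasure (armLaw h) :=
  Measure.isProbabilityMeasure_map measurable_argmax.aemeasurable

lemma posterior_real_Ioi {D T k : ℕ} (h : Fin k → Record D T) (d : Fin D) {y : ℝ} (h0 : 0 ≤ y)
    (h1 : y ≤ 1) : (betaMeasure (betaA h d) (betaB h d)).real (Set.Ioi y) =
      binCdf (pulls h d * T + 1) y (armSuccesses h d) := by
  rw [betaA_eq, betaB_eq, betaMeasure_real_Ioi _ _ h0 h1, Nat.add_sub_cancel' (armSuccesses_le h d)]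

lemma armLaw_real_le {D T k : ℕ} [NeZero D] (h : Fin k → Record D T) (c d : Fin D) {y : ℝ}
    (h0 : 0 ≤ y) (h1 : y < 1) :
    (armLaw h).real {d} ≤
      (1 / binCdf (pulls h c * T + 1) y (armSuccesses h c) - 1) * (armLaw h).real {c} +
        binCdf (pulls h d * T + 1) y (armSuccesses h d) := by
  have hp := binCdf_pos h0 h1 (pulls h c * T + 1) (armSuccesses h c)
  rw [← posterior_real_Ioi h c h0 h1.le] at hp ⊢
  rw [← posterior_real_Ioi h d h0 h1.le]
  exact pi_argmax_real_le (fun d => betaMeasure (betaA h d) (betaB h d)) c d hp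

lemma pulls_snoc {D T k : ℕ} (h : Fin k → Record D T) (a : Record D T) (d : Fin D) :
    pulls (Fin.snoc (α := fun _ => Record D T) h a : Fin (k + 1) → Record D T) d =
      pulls h d + if a.1 = d then 1 else 0 := by
  simp only [pulls, Fin.sum_univ_castSucc, Fin.snoc_castSucc, Fin.snoc_last]

lemma armSuccesses_snoc {D T k : ℕ} (h : Fin k → Record D T) (a : Record D T) (d : Fin D) :
    armSuccesses (Fin.snoc (α := fun _ => Record D T) h a : Fin (k + 1) → Record D T) d =
      armSuccesses h d + if a.1 = d then successes a.2 else 0 := by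
  simp [armSuccesses, Fin.sum_univ_castSucc]

/-! ### Measurability of the channel -/

lemma measurable_interference_term (net : Network) (i : ℕ) :
    Measurable fun z : (ℕ → Plane) × Slot =>
      if z.2.1 (i + 1) then rxPower net (z.2.2 (i + 1)) ‖z.1 i‖ₑ else 0 := by
  refine Measurable.ite ?_ ?_ measurable_const
  · have : Measurable fun z : (ℕ → Plane) × Slot => z.2.1 (i + 1) := by fun_prop
    exact this (measurableSet_singleton true)
  · unfold rxPower
    fun_prop

lemma measurable_sinr (net : Network) :
    Measurable fun z : (ℕ → Plane) × Slot => sinr net z.1 z.2 := by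
  have hI : Measurable fun z : (ℕ → Plane) × Slot => interference net z.1 z.2 :=
    Measurable.tsum (measurable_interference_term net)
  unfold sinr
  refine Measurable.div ?_ (measurable_const.add hI)
  unfold rxPower
  fun_prop

lemma measurable_slotAck (net : Network) :
    Measurable fun z : (ℕ → Plane) × Slot => slotAck net z.1 z.2 := by
  refine measurable_to_bool ?_
  have h1 : MeasurableSet {z : (ℕ → Plane) × Slot | z.2.1 0 = true} := by
    have : Measurable fun z : (ℕ → Plane) × Slot => z.2.1 0 := by fun_prop
    exact this (measurableSet_singleton true)
  have h2 : MeasurableSet {z : (ℕ → Plane) × Slot |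
      ENNReal.ofReal net.threshold < sinr net z.1 z.2} :=
    measurableSet_lt measurable_const (measurable_sinr net)
  have : (fun z : (ℕ → Plane) × Slot => slotAck net z.1 z.2) ⁻¹' {true} =
      {z | z.2.1 0 = true} ∩ {z | ENNReal.ofReal net.threshold < sinr net z.1 z.2} := by
    ext z; simp [slotAck]
  rw [this]
  exact h1.inter h2

instance isProbabilityMeasure_slotLaw (q : unitInterval) : IsProbabilityMeasure (slotLaw q) := by
  have : IsProbabilityMeasure (expMeasure 1) := isProbabilityMeasure_expMeasure one_pos
  unfold slotLaw; infer_instance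

lemma measurable_slotAck_right (net : Network) (x : ℕ → Plane) : Measurable (slotAck net x) :=
  (measurable_slotAck net).comp measurable_prodMk_left

instance isProbabilityMeasure_ackLaw (net : Network) (x : ℕ → Plane) (q : unitInterval) :
    IsProbabilityMeasure (ackLaw net x q) :=
  Measure.isProbabilityMeasure_map (measurable_slotAck_right net x).aemeasurable

lemma measurable_meanReward (net : Network) (q : unitInterval) :
    Measurable fun x => meanReward net x q := by
  have h := measurable_measure_prodMk_left (ν := slotLaw q)
    ((measurable_slotAck net) (measurableSet_singleton true))
  have e : (fun x => meanReward net x q) = fun x => (slotLaw q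
      (Prod.mk x ⁻¹' ((fun z : (ℕ → Plane) × Slot => slotAck net z.1 z.2) ⁻¹' {true}))).toReal := by
    ext x
    rw [meanReward, ackLaw, map_measureReal_apply (measurable_slotAck_right net x)
      (measurableSet_singleton true)]
    rfl
  rw [e]
  exact h.ennreal_toReal

lemma meanReward_nonneg (net : Network) (x : ℕ → Plane) (q : unitInterval) :
    0 ≤ meanReward net x q := measureReal_nonneg

lemma meanReward_le_one (net : Network) (x : ℕ → Plane) (q : unitInterval) :
    meanReward net x q ≤ 1 := measureReal_le_one

lemma ackLaw_real_singleton (net : Network) (x : ℕ → Plane) (q : unitInterval) (b : Bool) :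
    (ackLaw net x q).real {b} = if b then meanReward net x q else 1 - meanReward net x q := by
  cases b
  · have := probReal_compl_eq_one_sub (μ := ackLaw net x q) (measurableSet_singleton true)
    have e : ({true} : Set Bool)ᶜ = {false} := by ext b; cases b <;> simp
    rw [e] at this
    simpa [meanReward] using this
  · simp [meanReward]

instance isProbabilityMeasure_blockLaw (net : Network) (x : ℕ → Plane) (T : ℕ) (q : unitInterval) :
    IsProbabilityMeasure (blockLaw net x T q) := by
  unfold blockLaw; infer_instance

lemma blockLaw_real_singleton (net : Network) (x : ℕ → Plane) (T : ℕ) (q : unitInterval)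
    (s : Fin T → Bool) : (blockLaw net x T q).real {s} =
      ∏ t, if s t then meanReward net x q else 1 - meanReward net x q := by
  rw [blockLaw, measureReal_def, Measure.pi_singleton, ENNReal.toReal_prod]
  exact Finset.prod_congr rfl fun t _ => ackLaw_real_singleton net x q (s t)

/-! ### Averages over the successes of independent trials -/

/-- The operator that averages a function of the number of successes over one further trial of
success probability `q`. Its powers average over several independent trials. -/
def trialAvg (q : ℝ) : Module.End ℝ (ℕ → ℝ) :=
  q • LinearMap.funLeft ℝ ℝ Nat.succ + (1 - q) • 1

lemma trialAvg_apply (q : ℝ) (g : ℕ → ℝ) (s : ℕ) :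
    trialAvg q g s = q * g (s + 1) + (1 - q) * g s := by
  simp [trialAvg, LinearMap.funLeft_apply]

lemma trialAvg_pow_apply (q : ℝ) (n : ℕ) (g : ℕ → ℝ) (s : ℕ) :
    (trialAvg q ^ n) g s = ∑ i ∈ Finset.range (n + 1), binWeight n q i * g (s + i) := by
  have hshift : ∀ (i : ℕ) (g : ℕ → ℝ) (s : ℕ),
      ((LinearMap.funLeft ℝ ℝ Nat.succ : Module.End ℝ (ℕ → ℝ)) ^ i) g s = g (s + i) := by
    intro i
    induction i with
    | zero => intro g s; simp
    | succ i ih => intro g s; rw [pow_succ, Module.End.mul_apply, ih]; rfl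
  have hcomm : Commute (q • (LinearMap.funLeft ℝ ℝ Nat.succ : Module.End ℝ (ℕ → ℝ)))
      ((1 - q) • 1) := (Commute.one_right _).smul_right _
  rw [trialAvg, hcomm.add_pow]
  simp only [LinearMap.sum_apply, Finset.sum_apply]
  refine Finset.sum_congr rfl fun i _ => ?_
  rw [smul_pow, smul_pow, one_pow, ← Nat.cast_comm, ← nsmul_eq_mul]
  simp only [LinearMap.smul_apply, Pi.smul_apply, smul_eq_mul, mul_smul_comm, mul_one, hshift,
    binWeight]
  rw [nsmul_eq_mul]
  ring

lemma trialAvg_pow_nonneg {q : ℝ} (h0 : 0 ≤ q) (h1 : q ≤ 1) (n : ℕ) {g : ℕ → ℝ} {s : ℕ}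
    (hg : ∀ i ≤ n, 0 ≤ g (s + i)) : 0 ≤ (trialAvg q ^ n) g s := by
  rw [trialAvg_pow_apply]
  exact Finset.sum_nonneg fun i hi => mul_nonneg (binWeight_nonneg h0 h1 n i)
    (hg i (by simpa [Nat.lt_succ_iff] using hi))

lemma successes_cons {T : ℕ} (b : Bool) (s : Fin T → Bool) :
    successes (Fin.cons b s : Fin (T + 1) → Bool) = (if b then 1 else 0) + successes s := by
  simp only [successes, Finset.card_filter, Fin.sum_univ_succ, Fin.cons_zero, Fin.cons_succ]

lemma sum_prod_mul_successes (q : ℝ) (T : ℕ) (g : ℕ → ℝ) (a : ℕ) :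
    ∑ s : Fin T → Bool, (∏ t, if s t then q else 1 - q) * g (a + successes s) =
      (trialAvg q ^ T) g a := by
  induction T generalizing a with
  | zero => simp [successes]
  | succ T ih =>
    rw [← (Fin.consEquiv fun _ => Bool).sum_comp, Fintype.sum_prod_type, Fintype.sum_bool,
      pow_succ', Module.End.mul_apply, trialAvg_apply, ← ih, ← ih, Finset.mul_sum, Finset.mul_sum]
    have e : ∀ (b : Bool) (s : Fin T → Bool),
        (Fin.consEquiv fun _ => Bool) (b, s) = Fin.cons b s := fun _ _ => rfl
    congr 1
    · refine Finset.sum_congr rfl fun s _ => ?_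
      simp only [e, Fin.prod_univ_succ, Fin.cons_zero, Fin.cons_succ,
        successes_cons]
      simp [add_assoc, mul_assoc]
    · refine Finset.sum_congr rfl fun s _ => ?_
      simp only [e, Fin.prod_univ_succ, Fin.cons_zero, Fin.cons_succ,
        successes_cons]
      simp [mul_assoc]

/-! ### The law of a run -/

lemma integral_bind_of_finite {α β : Type*} [Fintype α] [Fintype β] [MeasurableSpace α]
    [MeasurableSpace β] [MeasurableSingletonClass α] [MeasurableSingletonClass β] (μ : Measure α)
    [IsProbabilityMeasure μ] (κ : α → Measure β) [∀ a, IsProbabilityMeasure (κ a)] (g : β → ℝ) :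
    ∫ b, g b ∂(μ.bind κ) = ∫ a, ∫ b, g b ∂(κ a) ∂μ := by
  have hκ : AEMeasurable κ μ := (Measurable.of_discrete).aemeasurable
  have : IsProbabilityMeasure (μ.bind κ) :=
    isProbabilityMeasure_bind hκ (Filter.Eventually.of_forall fun a => inferInstance)
  have hreal : ∀ b, (μ.bind κ).real {b} = ∑ a, μ.real {a} * (κ a).real {b} := by
    intro b
    rw [measureReal_def, Measure.bind_apply (measurableSet_singleton b) hκ, lintegral_fintype,
      ENNReal.toReal_sum fun a _ => ENNReal.mul_ne_top (measure_ne_top _ _) (measure_ne_top _ _)]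
    refine Finset.sum_congr rfl fun a _ => ?_
    rw [ENNReal.toReal_mul, mul_comm]; rfl
  rw [integral_fintype .of_finite, integral_fintype .of_finite]
  simp only [integral_fintype (Integrable.of_finite (μ := κ _)), hreal, smul_eq_mul,
    Finset.sum_mul, Finset.mul_sum]
  rw [Finset.sum_comm]
  simp only [mul_assoc]

lemma isProbabilityMeasure_bind_of_finite {α β : Type*} [Finite α] [MeasurableSpace α]
    [MeasurableSpace β] [MeasurableSingletonClass α] (μ : Measure α) [IsProbabilityMeasure μ]
    (κ : α → Measure β) [∀ a, IsProbabilityMeasure (κ a)] : IsProbabilityMeasure (μ.bind κ) :=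
  isProbabilityMeasure_bind (Measurable.of_discrete).aemeasurable
    (Filter.Eventually.of_forall fun _ => inferInstance)

lemma isProbabilityMeasure_step (net : Network) (x : ℕ → Plane) {D : ℕ} (p : Fin D → unitInterval)
    (T : ℕ) {k : ℕ} (h : Fin k → Record D T) (d : Fin D) :
    IsProbabilityMeasure ((blockLaw net x T (p d)).map fun s =>
      (Fin.snoc (α := fun _ => Record D T) h (d, s) : Fin (k + 1) → Record D T)) :=
  Measure.isProbabilityMeasure_map (Measurable.of_discrete).aemeasurable

variable (net : Network) (x : ℕ → Plane) {D : ℕ} [NeZero D] (p : Fin D → unitInterval) (T : ℕ)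

instance isProbabilityMeasure_runLaw (k : ℕ) : IsProbabilityMeasure (runLaw net x p T k) := by
  induction k with
  | zero => unfold runLaw; infer_instance
  | succ k ih =>
    have := isProbabilityMeasure_step net x p T (k := k)
    have : ∀ h : Fin k → Record D T, IsProbabilityMeasure ((armLaw h).bind fun d =>
        (blockLaw net x T (p d)).map fun s =>
          (Fin.snoc (α := fun _ => Record D T) h (d, s) : Fin (k + 1) → Record D T)) :=
      fun h => isProbabilityMeasure_bind_of_finite _ _
    exact isProbabilityMeasure_bind_of_finite _ _

/-- The expectation over one more block. -/
lemma integral_runLaw_succ (k : ℕ) (g : (Fin (k + 1) → Record D T) → ℝ) :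
    ∫ h, g h ∂(runLaw net x p T (k + 1)) =
      ∫ h, ∑ d, (armLaw h).real {d} * ∑ s, (blockLaw net x T (p d)).real {s} *
        g (Fin.snoc (α := fun _ => Record D T) h (d, s)) ∂(runLaw net x p T k) := by
  have := isProbabilityMeasure_step net x p T (k := k)
  have : ∀ h : Fin k → Record D T, IsProbabilityMeasure ((armLaw h).bind fun d =>
      (blockLaw net x T (p d)).map fun s =>
        (Fin.snoc (α := fun _ => Record D T) h (d, s) : Fin (k + 1) → Record D T)) :=
    fun h => isProbabilityMeasure_bind_of_finite _ _
  rw [runLaw, integral_bind_of_finite]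
  refine integral_congr_ae (Filter.Eventually.of_forall fun h => ?_)
  simp only
  rw [integral_bind_of_finite, integral_fintype .of_finite]
  refine Finset.sum_congr rfl fun d _ => ?_
  rw [integral_map (Measurable.of_discrete).aemeasurable .of_discrete, integral_fintype .of_finite]
  simp only [smul_eq_mul]

lemma sum_armLaw_real {k : ℕ} (h : Fin k → Record D T) : ∑ d, (armLaw h).real {d} = 1 := by
  rw [sum_measureReal_singleton]; simp

lemma sum_blockLaw_real (q : unitInterval) :
    ∑ s, (blockLaw net x T q).real {s} = 1 := by
  rw [sum_measureReal_singleton]; simp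

/-- Averaging a function of the history that sees the last block only through its arm. -/
lemma integral_runLaw_sum_arm (F : Fin D → ℝ) (K : ℕ) :
    ∫ h, ∑ k : Fin K, F (h k).1 ∂(runLaw net x p T K) =
      ∑ d, F d * ∑ k ∈ Finset.range K, ∫ h, (armLaw h).real {d} ∂(runLaw net x p T k) := by
  induction K with
  | zero => simp
  | succ K ih =>
    have e : ∀ h : Fin K → Record D T, (∑ d, (armLaw h).real {d} *
        ∑ s, (blockLaw net x T (p d)).real {s} * ∑ k : Fin (K + 1),
          F ((Fin.snoc (α := fun _ => Record D T) h (d, s) : Fin (K + 1) → Record D T) k).1) =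
        ∑ k : Fin K, F (h k).1 + ∑ d, F d * (armLaw h).real {d} := by
      intro h
      simp only [Fin.sum_univ_castSucc, Fin.snoc_castSucc, Fin.snoc_last, ← Finset.sum_mul,
        sum_blockLaw_real, one_mul, mul_add, Finset.sum_add_distrib, sum_armLaw_real]
      congr 1
      exact Finset.sum_congr rfl fun d _ => mul_comm _ _
    rw [integral_runLaw_succ]
    simp only [e]
    rw [integral_add .of_finite .of_finite, ih, integral_finsetSum _ fun _ _ => .of_finite]
    simp only [integral_const_mul, Finset.sum_range_succ, mul_add, Finset.sum_add_distrib]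

/-- A cost `φ` that depends on the number of past pulls of an arm and on its number of
successes, incurred when the arm is pulled, has expected total at most that of pulling the arm in
each of `K` blocks: `∑ i < m, trialAvg μ ^ (i * T) (φ (j + i)) s` is the cost of `m` consecutive
pulls from the state `(j, s)`, and together with the cost so far it is a supermartingale. -/
lemma sum_integral_armLaw_mul_le (d : Fin D) (φ : ℕ → ℕ → ℝ) (hφ : ∀ j s, s ≤ j * T → 0 ≤ φ j s)
    (K : ℕ) :
    ∑ k ∈ Finset.range K, ∫ h, φ (pulls h d) (armSuccesses h d) * (armLaw h).real {d}
        ∂(runLaw net x p T k) ≤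
      ∑ j ∈ Finset.range K, (trialAvg (meanReward net x (p d)) ^ (j * T)) (φ j) 0 := by
  set q := meanReward net x (p d) with hq
  have hq0 : 0 ≤ q := meanReward_nonneg _ _ _
  have hq1 : q ≤ 1 := meanReward_le_one _ _ _
  let V : ℕ → ℕ → ℕ → ℝ := fun m j => ∑ i ∈ Finset.range m, (trialAvg q ^ (i * T)) (φ (j + i))
  have hVapply : ∀ m j s, V m j s =
      ∑ i ∈ Finset.range m, (trialAvg q ^ (i * T)) (φ (j + i)) s := fun m j s => by
    simp only [V, Finset.sum_apply]
  have hV0 : ∀ j s, V 0 j s = 0 := fun j s => by simp [hVapply]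
  have hVsucc : ∀ m j s, V (m + 1) j s = φ j s + (trialAvg q ^ T) (V m (j + 1)) s := by
    intro m j s
    rw [hVapply, Finset.sum_range_succ']
    simp only [V, map_sum, Finset.sum_apply]
    rw [add_comm]
    congr 1
    · simp
    · refine Finset.sum_congr rfl fun i _ => ?_
      rw [← Module.End.mul_apply, ← pow_add, show T + i * T = (i + 1) * T by ring,
        show j + 1 + i = j + (i + 1) by ring]
  have hVmono : ∀ m j s, s ≤ j * T → V m j s ≤ V (m + 1) j s := by
    intro m j s hs
    rw [hVapply, hVapply, Finset.sum_range_succ]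
    have : 0 ≤ (trialAvg q ^ (m * T)) (φ (j + m)) s :=
      trialAvg_pow_nonneg hq0 hq1 _ fun i hi => hφ _ _ (by rw [add_mul]; omega)
    linarith
  -- One block.
  have hstep : ∀ k m, ∫ h, φ (pulls h d) (armSuccesses h d) * (armLaw h).real {d}
        ∂(runLaw net x p T k) + ∫ h, V m (pulls h d) (armSuccesses h d) ∂(runLaw net x p T (k + 1))
      ≤ ∫ h, V (m + 1) (pulls h d) (armSuccesses h d) ∂(runLaw net x p T k) := by
    intro k m
    rw [integral_runLaw_succ, ← integral_add .of_finite .of_finite]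
    refine integral_mono .of_finite .of_finite fun h => ?_
    simp only [pulls_snoc, armSuccesses_snoc]
    set j := pulls h d
    set s := armSuccesses h d
    have hs : s ≤ j * T := armSuccesses_le h d
    have hd : ∑ s' : Fin T → Bool, (blockLaw net x T (p d)).real {s'} *
        V m (j + 1) (s + successes s') = V (m + 1) j s - φ j s := by
      rw [hVsucc, ← sum_prod_mul_successes]
      simp only [blockLaw_real_singleton, ← hq]
      ring
    have harm : ∀ d' ∈ Finset.univ, (armLaw h).real {d'} * (∑ s' : Fin T → Bool,
          (blockLaw net x T (p d')).real {s'} * V m (j + if d' = d then 1 else 0)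
            (s + if d' = d then successes s' else 0)) ≤
        (armLaw h).real {d'} * (V (m + 1) j s - if d' = d then φ j s else 0) := by
      intro d' _
      refine mul_le_mul_of_nonneg_left ?_ measureReal_nonneg
      by_cases hdd : d' = d
      · subst hdd
        simp only [if_true]
        exact hd.le
      · simp only [if_neg hdd, add_zero, ← Finset.sum_mul, sum_blockLaw_real, one_mul, sub_zero]
        exact hVmono m j s hs
    refine (add_le_add_right (Finset.sum_le_sum harm) _).trans (le_of_eq ?_)
    simp only [mul_sub, Finset.sum_sub_distrib, ← Finset.sum_mul, sum_armLaw_real, mul_ite,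
      mul_zero, Finset.sum_ite_eq', Finset.mem_univ, if_true]
    ring
  obtain ⟨cost, hcost⟩ : ∃ cost : ℕ → ℝ, ∀ k, cost k = ∫ h, φ (pulls h d) (armSuccesses h d) *
      (armLaw h).real {d} ∂(runLaw net x p T k) := ⟨_, fun _ => rfl⟩
  simp only [← hcost] at hstep ⊢
  have htel : ∀ m k, ∑ i ∈ Finset.range m, cost (k + i) ≤
      ∫ h, V m (pulls h d) (armSuccesses h d) ∂(runLaw net x p T k) := by
    intro m
    induction m with
    | zero => intro k; simp [hV0]
    | succ m ih =>
      intro k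
      rw [Finset.sum_range_succ']
      have h1 := ih (k + 1)
      have h2 := hstep k m
      have e : ∀ i, k + 1 + i = k + (i + 1) := fun i => by ring
      simp only [e] at h1
      simp only [add_zero]
      linarith
  have h := htel K 0
  simp only [zero_add] at h
  refine h.trans (le_of_eq ?_)
  have e0 : ∀ h : Fin 0 → Record D T, V K (pulls h d) (armSuccesses h d) =
      ∑ j ∈ Finset.range K, (trialAvg q ^ (j * T)) (φ j) 0 := fun h => by
    simp [hVapply, pulls, armSuccesses]
  simp only [e0]
  simp

/-! ### The number of pulls of a suboptimal arm -/

lemma sum_range_le_of_le_div {f : ℕ → ℝ} {a b : ℝ} (hb : 0 ≤ b) (ha : 0 ≤ a) (h0 : f 0 ≤ a)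
    (h : ∀ j : ℕ, f (j + 1) ≤ b / (j + 1)) (K : ℕ) :
    ∑ j ∈ Finset.range K, f j ≤ a + b * (1 + Real.log K) := by
  rcases K with _ | K
  · simp; positivity
  · rw [Finset.sum_range_succ', add_comm]
    refine add_le_add h0 ((Finset.sum_le_sum fun j _ => h j).trans ?_)
    have e : ∑ j ∈ Finset.range K, b / ((j : ℝ) + 1) = b * (harmonic K : ℝ) := by
      rw [harmonic, Rat.cast_sum, Finset.mul_sum]
      exact Finset.sum_congr rfl fun j _ => by push_cast; rw [div_eq_mul_inv]
    rw [e]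
    refine mul_le_mul_of_nonneg_left ((harmonic_le_one_add_log K).trans ?_) hb
    rcases K.eq_zero_or_pos with hK | hK
    · simp [hK]
    · gcongr; omega

lemma sum_ite_mul_lt_le {T : ℕ} (hT : 0 < T) {L : ℝ} (hL : 0 ≤ L) (K : ℕ) :
    ∑ j ∈ Finset.range K, (if ((j * T : ℕ) : ℝ) < L then (1 : ℝ) else 0) ≤ L / T + 1 := by
  have hT' : (0 : ℝ) < T := by exact_mod_cast hT
  rw [← Finset.sum_filter, Finset.sum_const, nsmul_one]
  have hsub : (Finset.range K).filter (fun j => ((j * T : ℕ) : ℝ) < L) ⊆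
      Finset.range ⌈L / T⌉₊ := by
    intro j hj
    rw [Finset.mem_filter] at hj
    rw [Finset.mem_range, Nat.lt_ceil, lt_div_iff₀ hT']
    exact_mod_cast hj.2
  calc _ ≤ ((Finset.range ⌈L / T⌉₊).card : ℝ) := by exact_mod_cast Finset.card_le_card hsub
    _ = (⌈L / T⌉₊ : ℝ) := by rw [Finset.card_range]
    _ ≤ _ := (Nat.ceil_lt_add_one (by positivity)).le

lemma meanReward_le_iSup (net : Network) (x : ℕ → Plane) {D : ℕ} (p : Fin D → unitInterval)
    (d : Fin D) : meanReward net x (p d) ≤ ⨆ d, meanReward net x (p d) :=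
  le_ciSup (f := fun d => meanReward net x (p d)) (Set.finite_range _).bddAbove d

/-- The expected number of blocks in which arm `d` is used, among the first `K`. -/
def expectedPulls (K : ℕ) (d : Fin D) : ℝ :=
  ∑ k ∈ Finset.range K, ∫ h, (armLaw h).real {d} ∂(runLaw net x p T k)

lemma expectedPulls_nonneg (K : ℕ) (d : Fin D) : 0 ≤ expectedPulls net x p T K d :=
  Finset.sum_nonneg fun _ _ => integral_nonneg fun _ => measureReal_nonneg

lemma sum_expectedPulls (K : ℕ) : ∑ d, expectedPulls net x p T K d = K := by
  simp only [expectedPulls]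
  rw [Finset.sum_comm]
  simp_rw [← integral_finsetSum Finset.univ fun _ _ => Integrable.of_finite, sum_armLaw_real]
  simp

/-- For an arm of mean `u` that is pulled in every block, the expected odds against its sample
exceeding `u - e`, summed over the blocks. -/
lemma sum_odds_le {u e : ℝ} (he : 0 < e) (heu : 2 * e ≤ u) (hu : u ≤ 1) {T : ℕ} (hT : 0 < T)
    (K : ℕ) :
    ∑ j ∈ Finset.range K, (trialAvg u ^ (j * T))
        (fun s => 1 / binCdf (j * T + 1) (u - e) s - 1) 0 ≤
      1 / e + 25 / (T * e ^ 2) * (1 + Real.log K) := by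
  have hT' : (0 : ℝ) < T := by exact_mod_cast hT
  refine sum_range_le_of_le_div (by positivity) (by positivity) ?_ (fun j => ?_) K
  · have h1 : binCdf 1 (u - e) 0 = 1 - (u - e) := by simp [binCdf, binWeight]
    simp only [zero_mul, pow_zero, Module.End.one_apply, zero_add, h1]
    have : 1 / (1 - (u - e)) ≤ 1 / e := one_div_le_one_div_of_le he (by linarith)
    linarith
  · rw [trialAvg_pow_apply]
    simp only [zero_add]
    refine (sum_binWeight_odds_le he heu hu).trans ?_
    rw [div_div]
    refine div_le_div_of_nonneg_left (by norm_num) (by positivity) ?_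
    push_cast
    have : 0 < e ^ 2 := by positivity
    nlinarith

/-- For an arm of mean `u` that is pulled in every block, the expected number of blocks at whose
start it has been tried in fewer than `L` slots or has a success rate above `u + e`. -/
lemma sum_unsettled_le {u e L : ℝ} (he : 0 < e) (hu0 : 0 ≤ u) (hu : u ≤ 1) (hL : 0 ≤ L) {T : ℕ}
    (hT : 0 < T) (K : ℕ) :
    ∑ j ∈ Finset.range K, (trialAvg u ^ (j * T)) (fun s =>
        if ((j * T : ℕ) : ℝ) < L ∨ (u + e) * (j * T : ℕ) < s then (1 : ℝ) else 0) 0 ≤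
      L / T + 1 + 1 / (T * e ^ 2) * (1 + Real.log K) := by
  have hT' : (0 : ℝ) < T := by exact_mod_cast hT
  have hterm : ∀ j ∈ Finset.range K, (trialAvg u ^ (j * T)) (fun s =>
        if ((j * T : ℕ) : ℝ) < L ∨ (u + e) * (j * T : ℕ) < s then (1 : ℝ) else 0) 0 ≤
      (if ((j * T : ℕ) : ℝ) < L then (1 : ℝ) else 0) +
        ∑ i ∈ Finset.range (j * T + 1), binWeight (j * T) u i *
          (if (u + e) * (j * T : ℕ) < i then 1 else 0) := by
    intro j _
    rw [trialAvg_pow_apply]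
    have h1 := sum_binWeight (j * T) u
    have hone : (if ((j * T : ℕ) : ℝ) < L then (1 : ℝ) else 0) = ∑ i ∈ Finset.range (j * T + 1),
        binWeight (j * T) u i * (if ((j * T : ℕ) : ℝ) < L then 1 else 0) := by
      rw [← Finset.sum_mul, h1, one_mul]
    rw [hone, ← Finset.sum_add_distrib]
    refine Finset.sum_le_sum fun i _ => ?_
    have hb := binWeight_nonneg hu0 hu (j * T) i
    simp only [zero_add]
    by_cases h2 : ((j * T : ℕ) : ℝ) < L <;> by_cases h3 : (u + e) * (j * T : ℕ) < i <;>
      simp only [h2, h3, or_true, or_false, if_true, if_false, mul_one, mul_zero,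
        add_zero, zero_add, le_refl]
    linarith
  refine (Finset.sum_le_sum hterm).trans ?_
  rw [Finset.sum_add_distrib]
  refine add_le_add (sum_ite_mul_lt_le hT hL K) ?_
  have h := sum_range_le_of_le_div (f := fun j => ∑ i ∈ Finset.range (j * T + 1),
    binWeight (j * T) u i * (if (u + e) * (j * T : ℕ) < i then 1 else 0)) (a := 0)
    (b := 1 / (T * e ^ 2)) (by positivity) le_rfl (by simp) (fun j => ?_) K
  · rwa [zero_add] at h
  · refine (sum_binWeight_of_gt_le hu0 hu (by linarith : u < u + e) (by positivity)).trans
      (le_of_eq ?_)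
    push_cast
    rw [add_sub_cancel_left, div_div]
    congr 1; ring

/-- A suboptimal arm `d` is used because the sample of the better arm `c` is small, because its own
state is not yet typical, or because its own sample is large in spite of a typical state, which has
probability at most `1 / K`. -/
lemma expectedPulls_le {c d : Fin D} (hT : 0 < T) {K : ℕ} (hK : 0 < K) {δ : ℝ} (hδ : 0 < δ)
    (hcd : meanReward net x (p c) - meanReward net x (p d) = δ) :
    expectedPulls net x p T K d ≤
      2 + 2 / δ + (132 * (1 + Real.log K)) / (T * δ ^ 2) := by
  set u := meanReward net x (p c) with hu
  set v := meanReward net x (p d) with hv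
  have hu0 : 0 ≤ u := meanReward_nonneg _ _ _
  have hu1 : u ≤ 1 := meanReward_le_one _ _ _
  have hv0 : 0 ≤ v := meanReward_nonneg _ _ _
  have hv1 : v ≤ 1 := meanReward_le_one _ _ _
  have hT' : (0 : ℝ) < T := by exact_mod_cast hT
  have hK' : (0 : ℝ) < K := by exact_mod_cast hK
  have hlog : 0 ≤ Real.log K := Real.log_natCast_nonneg K
  set y := u - δ / 2 with hy
  have hy0 : 0 ≤ y := by linarith
  have hy1 : y < 1 := by linarith
  set L := 16 * Real.log K / δ ^ 2 with hL
  have hL0 : 0 ≤ L := by positivity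
  let odds : ℕ → ℕ → ℝ := fun j s => 1 / binCdf (j * T + 1) y s - 1
  let uns : ℕ → ℕ → ℝ := fun j s =>
    if ((j * T : ℕ) : ℝ) < L ∨ (v + δ / 4) * (j * T : ℕ) < s then 1 else 0
  have hodds : ∀ j s, 0 ≤ odds j s := fun j s => by
    have h1 := binCdf_pos hy0 hy1 (j * T + 1) s
    have h2 := binCdf_le_one hy0 hy1.le (j * T + 1) s
    simp only [odds, sub_nonneg]
    rw [le_div_iff₀ h1]; linarith
  have huns : ∀ j s, 0 ≤ uns j s := fun j s => by
    simp only [uns]; split_ifs <;> norm_num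
  have hpoint : ∀ {k : ℕ} (h : Fin k → Record D T), (armLaw h).real {d} ≤
      odds (pulls h c) (armSuccesses h c) * (armLaw h).real {c} +
        uns (pulls h d) (armSuccesses h d) * (armLaw h).real {d} + 1 / K := by
    intro k h
    have hc : 0 ≤ odds (pulls h c) (armSuccesses h c) * (armLaw h).real {c} :=
      mul_nonneg (hodds _ _) measureReal_nonneg
    have hKinv : 0 ≤ 1 / (K : ℝ) := by positivity
    by_cases hbad : ((pulls h d * T : ℕ) : ℝ) < L ∨
        (v + δ / 4) * (pulls h d * T : ℕ) < armSuccesses h d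
    · have : uns (pulls h d) (armSuccesses h d) = 1 := if_pos hbad
      rw [this]; linarith
    · have h0 : uns (pulls h d) (armSuccesses h d) = 0 := if_neg hbad
      push Not at hbad
      rw [h0, zero_mul, add_zero]
      refine (armLaw_real_le h c d hy0 hy1).trans (add_le_add_right ?_ _)
      set n := pulls h d * T
      have hyx : y - (v + δ / 4) = δ / 4 := by linarith
      have hx0 : 0 < v + δ / 4 := by linarith
      have hF : binCdf (n + 1) y (armSuccesses h d) ≤ (1 - (y - (v + δ / 4)) ^ 2) ^ (n + 1) := by
        refine binCdf_le_of_le hx0 (by linarith) hy1.le ?_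
        push_cast; linarith [hbad.2]
      refine hF.trans ?_
      rw [hyx]
      have hδ4 : δ / 4 ≤ 1 := by linarith
      have hexp : (1 - (δ / 4) ^ 2) ^ (n + 1) ≤ Real.exp (-(δ / 4) ^ 2) ^ (n + 1) :=
        pow_le_pow_left₀ (by nlinarith) (Real.one_sub_le_exp_neg _) _
      refine hexp.trans ?_
      rw [← Real.exp_nat_mul, one_div, ← Real.exp_log hK', ← Real.exp_neg]
      apply Real.exp_le_exp.2
      have h1 := hbad.1
      rw [hL, div_le_iff₀ (by positivity)] at h1
      push_cast
      nlinarith [sq_nonneg δ]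
  have hsum : expectedPulls net x p T K d ≤
      ∑ k ∈ Finset.range K, ∫ h, odds (pulls h c) (armSuccesses h c) * (armLaw h).real {c}
        ∂(runLaw net x p T k) +
      ∑ k ∈ Finset.range K, ∫ h, uns (pulls h d) (armSuccesses h d) * (armLaw h).real {d}
        ∂(runLaw net x p T k) + 1 := by
    have e : (1 : ℝ) = ∑ k ∈ Finset.range K, 1 / (K : ℝ) := by
      rw [Finset.sum_const, Finset.card_range, nsmul_eq_mul]; field_simp
    rw [e, ← Finset.sum_add_distrib, ← Finset.sum_add_distrib, expectedPulls]
    refine Finset.sum_le_sum fun k _ => ?_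
    have e2 : 1 / (K : ℝ) = ∫ _, 1 / (K : ℝ) ∂(runLaw net x p T k) := by simp
    rw [e2, ← integral_add .of_finite .of_finite, ← integral_add .of_finite .of_finite]
    exact integral_mono .of_finite .of_finite fun h => hpoint h
  have h1 := (sum_integral_armLaw_mul_le net x p T c odds (fun j s _ => hodds j s) K).trans
    (sum_odds_le (e := δ / 2) (by positivity) (by linarith) hu1 hT K)
  have h2 := (sum_integral_armLaw_mul_le net x p T d uns (fun j s _ => huns j s) K).trans
    (sum_unsettled_le (e := δ / 4) (by positivity) hv0 hv1 hL0 hT K)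
  refine (hsum.trans (add_le_add_left (add_le_add h1 h2) 1)).trans ?_
  have e3 : 1 / (δ / 2) + 25 / (T * (δ / 2) ^ 2) * (1 + Real.log K) +
      (L / T + 1 + 1 / (T * (δ / 4) ^ 2) * (1 + Real.log K)) + 1 =
      2 + 2 / δ + (116 * (1 + Real.log K) + 16 * Real.log K) / (T * δ ^ 2) := by
    rw [hL]; field_simp; ring
  rw [e3]
  gcongr
  linarith

/-! ### The regret -/

lemma condRegret_eq_sum (K : ℕ) : condRegret net x p T K =
    ∑ d, T * ((⨆ d, meanReward net x (p d)) - meanReward net x (p d)) *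
      expectedPulls net x p T K d :=
  integral_runLaw_sum_arm net x p T
    (fun d => (T : ℝ) * ((⨆ d, meanReward net x (p d)) - meanReward net x (p d))) K

lemma condRegret_nonneg (K : ℕ) : 0 ≤ condRegret net x p T K := by
  rw [condRegret_eq_sum]
  refine Finset.sum_nonneg fun d _ => mul_nonneg (mul_nonneg (Nat.cast_nonneg T) ?_)
    (expectedPulls_nonneg net x p T K d)
  exact sub_nonneg.2 (meanReward_le_iSup net x p d)

/-- The regret given the locations: arms whose gap is below `√(D * log K / (T * K))` cost little in
every block, the others are rarely used. -/
lemma condRegret_le {K : ℕ} (hTD : (T : ℝ) * D ≤ K * Real.log K) :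
    condRegret net x p T K ≤ 400 * √((T : ℝ) * K * D * Real.log K) := by
  have hD : (0 : ℝ) < D := by exact_mod_cast Nat.pos_of_ne_zero (NeZero.ne D)
  rcases Nat.eq_zero_or_pos T with hT | hT
  · rw [condRegret_eq_sum]; simp [hT]
  have hT' : (0 : ℝ) < T := by exact_mod_cast hT
  have hTDpos : 0 < (T : ℝ) * D := by positivity
  have hK2 : 2 ≤ K := by
    by_contra! h
    interval_cases K <;> simp at hTD <;> linarith
  have hK' : (0 : ℝ) < K := by positivity
  have hlog : 1 + Real.log K ≤ 5 / 2 * Real.log K := by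
    have h1 : Real.log 2 ≤ Real.log K := Real.log_le_log (by norm_num) (by exact_mod_cast hK2)
    linarith [Real.log_two_gt_d9]
  have hlog0 : 0 < Real.log K := Real.log_pos (by exact_mod_cast hK2)
  set l := Real.log K with hl
  set R := √((T : ℝ) * K * D * l) with hR
  have hR0 : 0 < R := Real.sqrt_pos.2 (by positivity)
  have hR2 : R ^ 2 = T * K * D * l := Real.sq_sqrt (by positivity)
  have hTDR : (T : ℝ) * D ≤ R := by
    refine abs_le_of_sq_le_sq' ?_ hR0.le |>.2
    rw [hR2]
    calc ((T : ℝ) * D) ^ 2 = T * D * (T * D) := by ring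
      _ ≤ T * D * (K * l) := by gcongr
      _ = _ := by ring
  -- `ε = √(D * l / (T * K))` balances the two kinds of arms.
  set ε := R / (T * K) with hε
  have hε0 : 0 < ε := by positivity
  obtain ⟨c, hc⟩ := exists_eq_ciSup_of_finite (f := fun d => meanReward net x (p d))
  rw [condRegret_eq_sum]
  have hterm : ∀ d ∈ Finset.univ,
      (T : ℝ) * ((⨆ d, meanReward net x (p d)) - meanReward net x (p d)) *
        expectedPulls net x p T K d ≤
      T * ε * expectedPulls net x p T K d + (4 * T + 330 * l / ε) := by
    intro d _
    set δ := (⨆ d, meanReward net x (p d)) - meanReward net x (p d) with hδ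
    have hN := expectedPulls_nonneg net x p T K d
    rcases le_or_gt δ ε with h | h
    · have h1 : (T : ℝ) * δ * expectedPulls net x p T K d ≤
          T * ε * expectedPulls net x p T K d := by gcongr
      have h2 : 0 ≤ 4 * (T : ℝ) + 330 * l / ε := by positivity
      linarith
    · have hδ0 : 0 < δ := hε0.trans h
      have hδ1 : δ ≤ 1 := by
        have h1 := meanReward_le_one net x (p c)
        have h2 := meanReward_nonneg net x (p d)
        rw [hδ, ← hc]; linarith
      have hb := expectedPulls_le net x p T (c := c) (d := d) hT (by omega : 0 < K) hδ0
        (by rw [hδ, ← hc])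
      have h3 : (T : ℝ) * δ * expectedPulls net x p T K d ≤
          T * δ * (2 + 2 / δ + (132 * (1 + l)) / (T * δ ^ 2)) := by gcongr
      have h4 : (T : ℝ) * δ * (2 + 2 / δ + (132 * (1 + l)) / (T * δ ^ 2)) =
          2 * T * δ + 2 * T + 132 * (1 + l) / δ := by field_simp
      have h5 : 132 * (1 + l) / δ ≤ 330 * l / ε :=
        div_le_div₀ (by positivity) (by linarith) hε0 h.le
      have h6 : 2 * (T : ℝ) * δ ≤ 2 * T := mul_le_of_le_one_right (by positivity) hδ1
      have h7 : 0 ≤ T * ε * expectedPulls net x p T K d := by positivity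
      linarith
  refine (Finset.sum_le_sum hterm).trans ?_
  rw [Finset.sum_add_distrib, ← Finset.mul_sum, sum_expectedPulls, Finset.sum_const,
    Finset.card_univ, Fintype.card_fin, nsmul_eq_mul]
  have e1 : (T : ℝ) * ε * K = R := by rw [hε]; field_simp
  have e2 : (D : ℝ) * (l / ε) = R := by
    rw [hε, div_div_eq_mul_div, ← mul_div_assoc, div_eq_iff hR0.ne', ← sq, hR2]; ring
  have e3 : (D : ℝ) * (4 * T + 330 * l / ε) = 4 * (T * D) + 330 * (D * (l / ε)) := by ring
  rw [e1, e3, e2]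
  linarith

/-- The weights of the finite law of a run are polynomials in the mean rewards. -/
lemma measurable_runLaw_real (k : ℕ) (h : Fin k → Record D T) :
    Measurable fun x => (runLaw net x p T k).real {h} := by
  classical
  induction k with
  | zero => simp only [runLaw]; exact measurable_const
  | succ k ih =>
    have e : (fun x => (runLaw net x p T (k + 1)).real {h}) = fun x =>
        ∑ h' : Fin k → Record D T, (runLaw net x p T k).real {h'} *
          ∑ d, (armLaw h').real {d} * ∑ s, (∏ t, if s t then meanReward net x (p d) else
            1 - meanReward net x (p d)) *
            if Fin.snoc (α := fun _ => Record D T) h' (d, s) = h then 1 else 0 := by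
      ext x
      have h1 := integral_runLaw_succ net x p T k fun h' => if h' = h then (1 : ℝ) else 0
      rw [integral_fintype .of_finite, integral_fintype .of_finite] at h1
      simpa [blockLaw_real_singleton] using h1
    rw [e]
    have hm : ∀ (d : Fin D) (s : Fin T → Bool), Measurable fun x =>
        ∏ t, if s t then meanReward net x (p d) else 1 - meanReward net x (p d) := fun d s => by
      refine Finset.measurable_fun_prod _ fun t _ => ?_
      split_ifs
      · exact measurable_meanReward net (p d)
      · exact measurable_const.sub (measurable_meanReward net (p d))
    exact Finset.measurable_fun_sum _ fun h' _ => (ih h').mul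
      (Finset.measurable_fun_sum _ fun d _ => measurable_const.mul
        (Finset.measurable_fun_sum _ fun s _ => (hm d s).mul measurable_const))

lemma measurable_condRegret (K : ℕ) : Measurable fun x => condRegret net x p T K := by
  have e : (fun x => condRegret net x p T K) = fun x => ∑ h : Fin K → Record D T,
      (runLaw net x p T K).real {h} * ∑ k : Fin K, (T : ℝ) *
        ((⨆ d, meanReward net x (p d)) - meanReward net x (p (h k).1)) := by
    ext x
    rw [condRegret, integral_fintype .of_finite]
    simp only [smul_eq_mul]
  rw [e]
  have hsup : Measurable fun x => ⨆ d, meanReward net x (p d) :=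
    Measurable.iSup fun d => measurable_meanReward net (p d)
  exact Finset.measurable_fun_sum _ fun h _ => (measurable_runLaw_real net p T K h).mul
    (Finset.measurable_fun_sum _ fun k _ => measurable_const.mul
      (hsup.sub (measurable_meanReward net _)))

end AlohaTS
end

theorem mainTheorem3 : ∃ C : ℝ, 0 < C ∧
    ∀ (Ω : Type*) [MeasurableSpace Ω] (P : Measure Ω) [IsProbabilityMeasure P]
      (net : AlohaTS.Network) (X : ℕ → Ω → AlohaTS.Plane)
      (_ : AlohaTS.IsPoissonProcess net.intensity X P)
      (D : ℕ) [NeZero D] (p : Fin D → unitInterval) (T K : ℕ)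
      (_ : (T : ℝ) * D ≤ K * Real.log K),
      Integrable (fun ω => AlohaTS.condRegret net (fun i => X i ω) p T K) P ∧
      AlohaTS.bayesRegret P X net p T K ≤ C * √((T : ℝ) * K * D * Real.log K) := by
  refine ⟨400, by norm_num, ?_⟩
  intro Ω _ P _ net X hX D _ p T K hTD
  have hle : ∀ ω, AlohaTS.condRegret net (fun i => X i ω) p T K ≤
      400 * √((T : ℝ) * K * D * Real.log K) := fun ω =>
    AlohaTS.condRegret_le net _ p T hTD
  have hmeas : Measurable fun ω => AlohaTS.condRegret net (fun i => X i ω) p T K :=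
    (AlohaTS.measurable_condRegret net p T K).comp
      (measurable_pi_lambda _ fun i => hX.measurable_point i)
  have hint : Integrable (fun ω => AlohaTS.condRegret net (fun i => X i ω) p T K) P := by
    refine Integrable.of_bound hmeas.aestronglyMeasurable
      (400 * √((T : ℝ) * K * D * Real.log K)) (Filter.Eventually.of_forall fun ω => ?_)
    rw [Real.norm_of_nonneg (AlohaTS.condRegret_nonneg net _ p T K)]
    exact hle ω
  refine ⟨hint, ?_⟩
  calc AlohaTS.bayesRegret P X net p T K
      ≤ ∫ _, 400 * √((T : ℝ) * K * D * Real.log K) ∂P :=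
        integral_mono hint (integrable_const _) hle
    _ = _ := by simp
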